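/- Let $\tilde L\subset\mathbb R^m\times\mathbb R^n$ be a lattice such that the projection $\pi_1$ to $\mathbb R^m$ is injective on $\tilde L$ and $\pi_2(\tilde L)$ is dense in $\mathbb R^n$. Put $L=\pi_1(\tilde L)$ and let $(\cdot)^*=\pi_2\circ(\pi_1|_{\tilde L})^{-1}:L\to\mathbb R^n$. Let $\Omega\subset\mathbb R^n$ be a non-empty compact set that is the closure of its interior and whose boundary has Lebesgue measure $0$, and let $\Lambda=\{x\in L: x^*\in\Omega\}$. Let $Q$ be a linear similarity of $\mathbb R^m$ with $QL=L$, and let $A=Q^*$ be a linear map of $\mathbb R^n$ with $(Qx)^*=Ax^*$ for all $x\in L$, all of whose (complex) eigenvalues are less than $1$ in absolute value. Assume that $\Omega_Q=\{u\in\mathbb R^n: A\Omega+u\subset\Omega\}$ has non-empty interior and that its boundary has Lebesgue measure $0$. Put $T=\{v\in L: v^*\in\Omega_Q\}$, $t_v(x)=Qx+v$ and $t_v^*(y)=Ay+v^*$ for $v\in T$, and $S_s=\{x\in S:|x|\le s\}$ for $S\subset\mathbb R^m$. Then there is a unique continuous function $f:\mathbb R^n\to\mathbb R$ with support in $\Omega$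 such that the function $p$ on $L$ given by $p(x)=\mathrm{vol}(\Omega)f(x^*)$ for $x\in\Lambda$ and $p(x)=0$ for $x\in L\setminus\Lambda$ is a $Q$-invariant density, i.e. $p\ge 0$ on $\Lambda$, $\lim_{s\to\infty}\frac{|\det Q|}{\#T_s}\sum_{v\in T_s}p(t_v^{-1}x)=p(x)$ for all $x\in L$, and $\lim_{s\to\infty}\frac1{\#\Lambda_s}\sum_{x\in\Lambda_s}p(x)=1$. Let $\mu_f=f\,dx$. For every $s>0$ with $T_s\neq\emptyset$ (that is, for every $s>0$ if $A\Omega\subset\Omega$, and for all sufficiently large $s$ in any case) there is a unique Borel probability measure $\mu_s$ on $\Omega$, the Hutchinson measure, with $$\mu_s=\frac1{\#T_s}\sum_{v\in T_s}t_v^*\cdot\mu_s ,\qquad (t_v^*\cdot\mu)(Y)=\mu\big((t_v^*)^{-1}(Y)\big).$$ With $\hat\mu(k)=\int e^{-2\pi i k\cdot x}\,d\mu(x)$ and $g_s(k)=\frac1{\#T_s}\sum_{v\in T_s}e^{-2\pi i k\cdot v^*}$ for $k\in\mathbb R^n$: (i) $\hat\mu_s(k)=\prod_{N=0}^\infty g_s((A^t)^Nk)$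 for every $k\in\mathbb R^n$ and every $s>0$ with $T_s\ne\emptyset$, the product being unconditionally convergent; (ii) $\hat\mu_s\to\hat\mu_f$ as $s\to\infty$, uniformly on compact subsets of $\mathbb R^n$; (iii) $\mu_s\to\mu_f$ weakly as $s\to\infty$: $\int\varphi\,d\mu_s\to\int\varphi\,d\mu_f$ for every continuous $\varphi:\mathbb R^n\to\mathbb C$, in particular for every continuous $\varphi$ with support in $\Omega$. -/

import Mathlib

open MeasureTheory Filter Topology
open scoped ENNReal

noncomputable section

/-- The Euclidean space `ℝ^d`. -/
abbrev Euc (d : ℕ) : Type := EuclideanSpace ℝ (Fin d)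

/-- A cut and project scheme: a lattice (discrete subgroup spanning the whole space) in
`ℝ^m × ℝ^n` which projects injectively to the physical space `ℝ^m` and densely to the internal
space `ℝ^n`. -/
structure CutAndProject (m n : ℕ) where
  /-- the lattice `L̃` -/
  lattice : Submodule ℤ (Euc m × Euc n)
  discrete : DiscreteTopology lattice
  span_eq_top : Submodule.span ℝ (lattice : Set (Euc m × Euc n)) = ⊤
  injOn_fst : Set.InjOn Prod.fst (lattice : Set (Euc m × Euc n))
  dense_snd : Dense (Prod.snd '' (lattice : Set (Euc m × Euc n)))

/-- The part of `S` in the closed ball of radius `s` around the origin. -/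
def truncate {m : ℕ} (S : Set (Euc m)) (s : ℝ) : Set (Euc m) := {x | x ∈ S ∧ ‖x‖ ≤ s}

namespace CutAndProject

variable {m n : ℕ} (C : CutAndProject m n)

/-- `L = π₁(L̃)`. -/
def L : Set (Euc m) := Prod.fst '' (C.lattice : Set (Euc m × Euc n))

/-- The star map `π₂ ∘ (π₁|L̃)⁻¹` (only its values on `L` are meaningful). -/
def star (x : Euc m) : Euc n :=
  (Function.invFunOn Prod.fst (C.lattice : Set (Euc m × Euc n)) x).2

/-- The cut and project set `Λ(Ω) = {x ∈ L | x* ∈ Ω}`. -/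
def modelSet (Ω : Set (Euc n)) : Set (Euc m) := {x | x ∈ C.L ∧ C.star x ∈ Ω}

end CutAndProject

/-- Windows of model sets: compact, the closure of their interior, with Lebesgue-null boundary.
The empty window is excluded. -/
structure IsWindow {n : ℕ} (Ω : Set (Euc n)) : Prop where
  nonempty : Ω.Nonempty
  isCompact : IsCompact Ω
  closure_interior : Ω = closure (interior Ω)
  frontier_null : volume (frontier Ω) = 0

/-- `Ω_Q = {u | A Ω + u ⊆ Ω}`, where `A = Q*`. -/
def windowQ {n : ℕ} (A : Euc n →ₗ[ℝ] Euc n) (Ω : Set (Euc n)) : Set (Euc n) :=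
  {u | ∀ y ∈ Ω, A y + u ∈ Ω}

/-- `Q` is a linear similarity `q R` (`R` orthogonal, `q ≠ 0`) with `Q L = L`, and `A = Q*` is the
linear map of internal space induced by `Q`, with all eigenvalues of modulus less than one;
moreover `Q` is compatible with `Λ(Ω)`: `Ω_Q` has an interior point, and a null boundary. -/
structure IsCompatibleSimilarity {m n : ℕ} (C : CutAndProject m n) (Ω : Set (Euc n))
    (Q : Euc m ≃ₗ[ℝ] Euc m) (A : Euc n →ₗ[ℝ] Euc n) : Prop where
  similarity : ∃ (q : ℝ) (R : Euc m ≃ₗᵢ[ℝ] Euc m), q ≠ 0 ∧ ∀ x, Q x = q • R x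
  image_L : Q '' C.L = C.L
  star_map : ∀ x ∈ C.L, C.star (Q x) = A (C.star x)
  eigenvalue_lt_one : ∀ z : ℂ, Polynomial.aeval z (LinearMap.charpoly A) = 0 → ‖z‖ < 1
  interior_nonempty : (interior (windowQ A Ω)).Nonempty
  frontier_null : volume (frontier (windowQ A Ω)) = 0

namespace CutAndProject

variable {m n : ℕ} (C : CutAndProject m n)

/-- `T = {v ∈ L | v* ∈ Ω_Q}`, the translation parts of the self-similarities `x ↦ Q x + v`
of `Λ(Ω)`. -/
def transl (Ω : Set (Euc n)) (A : Euc n →ₗ[ℝ] Euc n) : Set (Euc m) :=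
  C.modelSet (windowQ A Ω)

/-- The contraction `t*_v : y ↦ A y + v*` of internal space. -/
def tStar (A : Euc n →ₗ[ℝ] Euc n) (v : Euc m) (y : Euc n) : Euc n := A y + C.star v

open Classical in
/-- The function `p_f` on `L` attached to `f`: it is `vol(Ω) f(x*)` on `Λ(Ω)` and `0` off it. -/
def density (Ω : Set (Euc n)) (f : Euc n → ℝ) (x : Euc m) : ℝ :=
  if x ∈ C.modelSet Ω then volume.real Ω * f (C.star x) else 0

/-- `p` is a `Q`-invariant density on `Λ(Ω)`: it is non-negative, it equals its average over all
self-similarities `t_v : x ↦ Q x + v` (so `t_v⁻¹ x = Q⁻¹ (x - v)`), and its mean on `Λ(Ω)` is `1`. -/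
structure IsInvariantDensity (Ω : Set (Euc n)) (Q : Euc m ≃ₗ[ℝ] Euc m) (A : Euc n →ₗ[ℝ] Euc n)
    (p : Euc m → ℝ) : Prop where
  nonneg : ∀ x ∈ C.modelSet Ω, 0 ≤ p x
  average : ∀ x ∈ C.L, Tendsto
    (fun s : ℝ => |LinearMap.det (Q : Euc m →ₗ[ℝ] Euc m)| /
        ((truncate (C.transl Ω A) s).ncard : ℝ) *
      ∑ᶠ v ∈ truncate (C.transl Ω A) s, p (Q.symm (x - v))) atTop (𝓝 (p x))
  normalized : Tendsto
    (fun s : ℝ => ((truncate (C.modelSet Ω) s).ncard : ℝ)⁻¹ *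
      ∑ᶠ x ∈ truncate (C.modelSet Ω) s, p x) atTop (𝓝 1)

/-- `f` is the internal-space form of a `Q`-invariant density: `f` is continuous, is supported
in `Ω`, and `p_f` is a `Q`-invariant density. -/
structure IsInvariantWindowDensity (Ω : Set (Euc n)) (Q : Euc m ≃ₗ[ℝ] Euc m)
    (A : Euc n →ₗ[ℝ] Euc n) (f : Euc n → ℝ) : Prop where
  continuous : Continuous f
  support_subset : tsupport f ⊆ Ω
  invariant : C.IsInvariantDensity Ω Q A (C.density Ω f)

/-- `μ` is a Hutchinson measure of the family `t*_v`, `v ∈ T_s`, with equal weights: a Borel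
probability measure concentrated on `Ω` with `μ = (1/#T_s) ∑_{v ∈ T_s} t*_v · μ`. -/
structure IsHutchinsonMeasure (Ω : Set (Euc n)) (A : Euc n →ₗ[ℝ] Euc n) (s : ℝ)
    (μ : Measure (Euc n)) : Prop where
  isProbabilityMeasure : IsProbabilityMeasure μ
  compl_null : μ Ωᶜ = 0
  invariant : μ = ((truncate (C.transl Ω A) s).ncard : ℝ≥0∞)⁻¹ •
    ∑ᶠ v ∈ truncate (C.transl Ω A) s, μ.map (C.tStar A v)

/-- `g_s(k) = (1/#T_s) ∑_{v ∈ T_s} exp(-2πi k·v*)` for `k` in the (dual of) internal space. -/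
def expAverage (Ω : Set (Euc n)) (A : Euc n →ₗ[ℝ] Euc n) (s : ℝ) (k : Euc n) : ℂ :=
  ((truncate (C.transl Ω A) s).ncard : ℂ)⁻¹ *
    ∑ᶠ v ∈ truncate (C.transl Ω A) s,
      Complex.exp (-2 * Real.pi * Complex.I * (inner ℝ k (C.star v) : ℝ))

end CutAndProject

/-- The Fourier transform of a measure, `μ̂(k) = ∫ exp(-2πi k·x) dμ(x)`. -/
def fourierMeasure {n : ℕ} (μ : Measure (Euc n)) (k : Euc n) : ℂ :=
  ∫ x, Complex.exp (-2 * Real.pi * Complex.I * (inner ℝ k x : ℝ)) ∂μ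

/-- The measure `μ_f = f dx` of a non-negative density `f`. -/
def densityMeasure {n : ℕ} (f : Euc n → ℝ) : Measure (Euc n) :=
  volume.withDensity fun x => ENNReal.ofReal (f x)

end

/-!
Invariance of a density means that the measure `f dy` on internal space is self-similar, and the
whole statement is about self-similar measures.

**Self-similar measures.** For a probability measure `ν` carried by `Ω_Q`, call `μ` self-similar
with weights `ν` if `μ = ν ∗ A_* μ`, that is `μ̂(k) = ν̂(k) μ̂(Aᵗ k)`. All eigenvalues of `A` are
less than one in modulus, so by Gelfand's formula the norms of the powers of `Aᵗ` are summable and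
iterating the functional equation gives `μ̂(k) = ∏ ν̂((Aᵗ)^N k)`
(`tendsto_prod_charFun`, `hasProd_charFun`); in particular `μ` is unique. It exists because the
probability measures on the compact set `Ω` form a compact space (`exists_eq_conv_map`). The same
compactness and uniqueness show that `μ` depends continuously on `ν`
(`tendsto_of_charFun_selfSimilar`), and the Fourier transforms of measures on `Ω` are
equi-Lipschitz, which makes their convergence locally uniform.

**The two kinds of weights.** The Hutchinson measure `μ_s` is the self-similar measure whose weights
are the empirical measure of `T_s*` (`starMeasure`). For the uniform measure on `Ω_Q` the
self-similar measure has density `y ↦ μ {z | y - A z ∈ Ω_Q} / vol(Ω_Q)`, which is continuous because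
the boundary of `Ω_Q` is null (`smul_restrict_conv_map`, `continuous_measure_sub_mem`); by a change
of variables and `|det Q| |det A| = 1` (`Q × A` is an automorphism of the lattice), the invariant
densities are exactly the densities of this kind (`isInvariantWindowDensity_iff`).

**Uniform distribution.** Both the translation of the invariance condition into internal space and
the convergence of the weights as `s → ∞` rest on the uniform distribution of model sets
(`tendsto_average_truncate_modelSet`). With `N(s, φ)` the sum of `φ (x*)` over the points `x` of `L`
with `‖x‖ ≤ s`, translating `φ` by `x₀*`, `x₀ ∈ L`, changes `N(s, φ)` only by the contribution of a
spherical shell, which is `o(s ^ m)`; as `L*` is dense the same holds for all translations. Hence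
`N(s, φ * ψ)` (convolution) is asymptotic both to `N(s, φ) ∫ ψ` and to `N(s, ψ) ∫ φ`, so `N(s, ·)`
is asymptotically proportional to Lebesgue measure. Since `N(s, ψ)` grows like `s ^ m` for a suitable
`ψ`, quotients of such sums converge to quotients of integrals.
-/

/-! ### Lattice points in strips: the star map and counting -/

instance {m n : ℕ} : Measure.IsAddHaarMeasure (volume : Measure (Euc m × Euc n)) :=
  inferInstanceAs (((volume : Measure (Euc m)).prod (volume : Measure (Euc n))).IsAddHaarMeasure)

namespace CutAndProject

variable {m n : ℕ} (C : CutAndProject m n)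

lemma mk_star_mem {x : Euc m} (hx : x ∈ C.L) : (x, C.star x) ∈ C.lattice := by
  have h := Function.invFunOn_mem (f := Prod.fst) hx
  have h2 := Function.invFunOn_eq (f := Prod.fst) hx
  have : (x, C.star x) = Function.invFunOn Prod.fst (C.lattice : Set (Euc m × Euc n)) x :=
    Prod.ext h2.symm rfl
  rw [this]
  exact h

lemma fst_mem_L {p : Euc m × Euc n} (hp : p ∈ C.lattice) : p.1 ∈ C.L := ⟨p, hp, rfl⟩

lemma star_fst {p : Euc m × Euc n} (hp : p ∈ C.lattice) : C.star p.1 = p.2 := by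
  have : (p.1, C.star p.1) = p := C.injOn_fst (C.mk_star_mem (C.fst_mem_L hp)) hp rfl
  exact (Prod.ext_iff.1 this).2

lemma add_mem_L {x y : Euc m} (hx : x ∈ C.L) (hy : y ∈ C.L) : x + y ∈ C.L :=
  C.fst_mem_L (C.lattice.add_mem (C.mk_star_mem hx) (C.mk_star_mem hy))

lemma sub_mem_L {x y : Euc m} (hx : x ∈ C.L) (hy : y ∈ C.L) : x - y ∈ C.L :=
  C.fst_mem_L (C.lattice.sub_mem (C.mk_star_mem hx) (C.mk_star_mem hy))

lemma star_add {x y : Euc m} (hx : x ∈ C.L) (hy : y ∈ C.L) :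
    C.star (x + y) = C.star x + C.star y :=
  C.star_fst (C.lattice.add_mem (C.mk_star_mem hx) (C.mk_star_mem hy))

lemma star_sub {x y : Euc m} (hx : x ∈ C.L) (hy : y ∈ C.L) :
    C.star (x - y) = C.star x - C.star y :=
  C.star_fst (C.lattice.sub_mem (C.mk_star_mem hx) (C.mk_star_mem hy))

lemma dense_star_image : Dense (C.star '' C.L) := by
  refine C.dense_snd.mono ?_
  rintro _ ⟨p, hp, rfl⟩
  exact ⟨p.1, C.fst_mem_L hp, C.star_fst hp⟩

instance : DiscreteTopology C.lattice := C.discrete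

instance : IsZLattice ℝ C.lattice := ⟨C.span_eq_top⟩

lemma finite_truncate_modelSet {K : Set (Euc n)} (hK : Bornology.IsBounded K) (s : ℝ) :
    (truncate (C.modelSet K) s).Finite := by
  have hb : Bornology.IsBounded (Metric.closedBall (0 : Euc m) s ×ˢ K) :=
    Metric.isBounded_closedBall.prod hK
  have hfin : ((Metric.closedBall (0 : Euc m) s ×ˢ K) ∩
      (C.lattice : Set (Euc m × Euc n))).Finite := by
    have := ZSpan.setFinite_inter
      ((Module.Free.chooseBasis ℤ C.lattice).ofZLatticeBasis ℝ C.lattice) hb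
    rwa [Module.Basis.ofZLatticeBasis_span] at this
  refine (hfin.image Prod.fst).subset ?_
  rintro x ⟨⟨hx, hxK⟩, hxs⟩
  exact ⟨(x, C.star x), ⟨⟨by simpa using hxs, hxK⟩, C.mk_star_mem hx⟩, rfl⟩

/-- A fundamental parallelepiped of the lattice, with the properties used for counting points. -/
lemma exists_bounded_fundamentalDomain : ∃ (D : Set (Euc m × Euc n)) (r : ℝ),
    MeasurableSet D ∧ 0 < volume.real D ∧ 0 < r ∧ (∀ p ∈ D, ‖p‖ ≤ r) ∧
    (∀ z, ∃ p ∈ C.lattice, z - p ∈ D) ∧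
    (∀ p ∈ C.lattice, ∀ q ∈ C.lattice, ∀ z, z - p ∈ D → z - q ∈ D → p = q) := by
  set b := (Module.Free.chooseBasis ℤ C.lattice).ofZLatticeBasis ℝ C.lattice with hb
  have hspan : Submodule.span ℤ (Set.range b) = C.lattice :=
    Module.Basis.ofZLatticeBasis_span ℝ C.lattice _
  obtain ⟨r, hr0, hr⟩ := (ZSpan.fundamentalDomain_isBounded b).exists_pos_norm_le
  have hlt : volume (ZSpan.fundamentalDomain b) < ⊤ :=
    (ZSpan.fundamentalDomain_isBounded b).measure_lt_top
  refine ⟨ZSpan.fundamentalDomain b, r, ZSpan.fundamentalDomain_measurableSet b,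
    ENNReal.toReal_pos (ZSpan.measure_fundamentalDomain_ne_zero b) hlt.ne, hr0, hr, ?_, ?_⟩
  · intro z
    exact ⟨ZSpan.floor b z, hspan.le (ZSpan.floor b z).2, ZSpan.fract_mem_fundamentalDomain b z⟩
  · intro p hp q hq z hzp hzq
    have h1 := ZSpan.fract_eq_self.2 hzp
    have h2 := ZSpan.fract_eq_self.2 hzq
    have hp' : -p ∈ Submodule.span ℤ (Set.range b) := by rw [hspan]; exact neg_mem hp
    have hq' : -q ∈ Submodule.span ℤ (Set.range b) := by rw [hspan]; exact neg_mem hq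
    rw [sub_eq_add_neg, ZSpan.fract_add_ZSpan b z hp', ← sub_eq_add_neg] at h1
    rw [sub_eq_add_neg, ZSpan.fract_add_ZSpan b z hq', ← sub_eq_add_neg] at h2
    exact sub_right_injective (h1.symm.trans h2)

lemma volume_real_closedBall {d : ℕ} {a : ℝ} (ha : 0 ≤ a) :
    volume.real (Metric.closedBall (0 : Euc d) a) =
      a ^ d * volume.real (Metric.ball (0 : Euc d) 1) := by
  rw [Measure.real, Measure.addHaar_closedBall _ _ ha, ENNReal.toReal_mul,
    ENNReal.toReal_ofReal (by positivity), finrank_euclideanSpace_fin]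
  rfl

lemma volume_real_ball_pos (d : ℕ) : 0 < volume.real (Metric.ball (0 : Euc d) 1) :=
  ENNReal.toReal_pos (Metric.measure_ball_pos _ _ one_pos).ne' measure_ball_lt_top.ne

lemma volume_real_prod {S : Set (Euc m)} {S' : Set (Euc n)} :
    volume.real (S ×ˢ S') = volume.real S * volume.real S' := by
  rw [Measure.volume_eq_prod, measureReal_prod_prod]

/-- The number of lattice points in a spherical shell times a ball is at most a constant times the
volume of a slightly thicker shell. -/
lemma exists_card_shell_le (R : ℝ) : ∃ c r : ℝ, 0 < r ∧ 0 ≤ c ∧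
    ∀ (F : Finset (Euc m)) (a b : ℝ), b ≤ a + r →
      (∀ x ∈ F, x ∈ C.L ∧ b + r < ‖x‖ ∧ ‖x‖ ≤ a ∧ ‖C.star x‖ ≤ R) →
      (F.card : ℝ) ≤ c * (volume.real (Metric.closedBall (0 : Euc m) (a + r)) -
        volume.real (Metric.closedBall (0 : Euc m) b)) := by
  obtain ⟨D, r, hDm, hD0, hr0, hDr, -, hDd⟩ := C.exists_bounded_fundamentalDomain
  set w := volume.real (Metric.closedBall (0 : Euc n) (R + r)) with hw
  refine ⟨w / volume.real D, r, hr0, by positivity, fun F a b hab hF => ?_⟩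
  set S := (Metric.closedBall (0 : Euc m) (a + r) \ Metric.closedBall (0 : Euc m) b) ×ˢ
    Metric.closedBall (0 : Euc n) (R + r) with hS
  have hSfin : volume S ≠ ⊤ := by
    have : Bornology.IsBounded S :=
      (Metric.isBounded_closedBall.subset Set.sdiff_subset).prod Metric.isBounded_closedBall
    exact this.measure_lt_top.ne
  have hSvol : volume.real S = w * (volume.real (Metric.closedBall (0 : Euc m) (a + r)) -
      volume.real (Metric.closedBall (0 : Euc m) b)) := by
    rw [hS, volume_real_prod, measureReal_sdiff
      (Metric.closedBall_subset_closedBall hab) measurableSet_closedBall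
      (by simpa using measure_closedBall_lt_top.ne), ← hw]
    ring
  have hvol : ∀ x ∈ F, volume.real ((fun z => z - (x, C.star x)) ⁻¹' D) = volume.real D := by
    intro x _
    have := measure_preimage_add_right (volume : Measure (Euc m × Euc n)) (-(x, C.star x)) D
    simp only [← sub_eq_add_neg] at this
    rw [Measure.real, this]; rfl
  have hdisj : Set.PairwiseDisjoint (F : Set (Euc m))
      (fun x => (fun z => z - (x, C.star x)) ⁻¹' D) := by
    intro x hx y hy hxy
    refine Set.disjoint_left.2 fun z hzx hzy => hxy ?_
    have := hDd _ (C.mk_star_mem (hF x hx).1) _ (C.mk_star_mem (hF y hy).1) z hzx hzy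
    exact congrArg Prod.fst this
  have hsub : (⋃ x ∈ F, (fun z => z - (x, C.star x)) ⁻¹' D) ⊆ S := by
    refine Set.iUnion₂_subset fun x hx z hz => ?_
    obtain ⟨-, h1, h2, h3⟩ := hF x hx
    have hz' := hDr _ hz
    have hz1 : ‖z.1 - x‖ ≤ r := (norm_fst_le (z - (x, C.star x))).trans hz'
    have hz2 : ‖z.2 - C.star x‖ ≤ r := (norm_snd_le (z - (x, C.star x))).trans hz'
    have e1 := norm_sub_norm_le x z.1
    rw [norm_sub_rev] at e1
    have e2 := norm_sub_norm_le z.1 x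
    have e3 := norm_sub_norm_le z.2 (C.star x)
    simp only [hS, Set.mem_prod, Set.mem_sdiff, mem_closedBall_zero_iff, not_le]
    refine ⟨⟨?_, ?_⟩, ?_⟩ <;> linarith
  have key : (F.card : ℝ) * volume.real D ≤ volume.real S := by
    calc (F.card : ℝ) * volume.real D
        = ∑ x ∈ F, volume.real ((fun z => z - (x, C.star x)) ⁻¹' D) := by
          rw [Finset.sum_congr rfl hvol]; simp
      _ = volume.real (⋃ x ∈ F, (fun z => z - (x, C.star x)) ⁻¹' D) := by
          rw [measureReal_biUnion_finset hdisj
            (fun x _ => (measurable_id.sub_const _) hDm)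
            (fun x hx => (((measure_mono (Set.subset_biUnion_of_mem
              (u := fun x => (fun z => z - (x, C.star x)) ⁻¹' D) hx)).trans
              (measure_mono hsub)).trans_lt hSfin.lt_top).ne)]
      _ ≤ volume.real S := measureReal_mono hsub hSfin
  rw [div_mul_eq_mul_div, le_div_iff₀ hD0, ← hSvol]
  exact key

/-- Lattice points in a large enough strip are relatively dense, so that their number in a ball
of radius `s` grows at least like `s ^ m`. -/
lemma exists_le_card_truncate : ∃ c R r : ℝ, 0 < c ∧ 0 < r ∧ ∀ (s : ℝ), r ≤ s →
    ∀ (F : Finset (Euc m)), (∀ x ∈ C.L, ‖x‖ ≤ s → ‖C.star x‖ ≤ R → x ∈ F) →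
      c * (s - r) ^ m ≤ F.card := by
  obtain ⟨D, r, hDm, hD0, hr0, hDr, hDs, -⟩ := C.exists_bounded_fundamentalDomain
  set v := volume.real (Metric.ball (0 : Euc m) 1) with hv
  set w := volume.real (Metric.closedBall (0 : Euc n) 1) with hw
  have hv0 : 0 < v := volume_real_ball_pos m
  have hw0 : 0 < w := ENNReal.toReal_pos (Metric.measure_closedBall_pos _ _ one_pos).ne'
    measure_closedBall_lt_top.ne
  refine ⟨v * w / volume.real D, 1 + r, r, by positivity, hr0, fun s hs F hF => ?_⟩
  set S := Metric.closedBall (0 : Euc m) (s - r) ×ˢ Metric.closedBall (0 : Euc n) 1 with hS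
  have hSvol : volume.real S = v * w * (s - r) ^ m := by
    rw [hS, volume_real_prod, volume_real_closedBall (by linarith), ← hv, ← hw]
    ring
  have hvol : ∀ x ∈ F, volume ((fun z => z - (x, C.star x)) ⁻¹' D) = volume D := by
    intro x _
    have := measure_preimage_add_right (volume : Measure (Euc m × Euc n)) (-(x, C.star x)) D
    simpa only [← sub_eq_add_neg] using this
  have hDfin : volume D ≠ ⊤ := fun h => by simp [Measure.real, h] at hD0
  have hsub : S ⊆ ⋃ x ∈ F, (fun z => z - (x, C.star x)) ⁻¹' D := by
    intro z hz
    obtain ⟨p, hp, hzp⟩ := hDs z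
    have hz' := hDr _ hzp
    have hz1 : ‖z.1 - p.1‖ ≤ r := (norm_fst_le (z - p)).trans hz'
    have hz2 : ‖z.2 - p.2‖ ≤ r := (norm_snd_le (z - p)).trans hz'
    simp only [hS, Set.mem_prod, mem_closedBall_zero_iff] at hz
    have e1 := norm_sub_norm_le p.1 z.1
    have e2 := norm_sub_norm_le p.2 z.2
    rw [norm_sub_rev] at e1 e2
    refine Set.mem_biUnion (x := p.1) (hF _ (C.fst_mem_L hp) (by linarith) ?_) ?_
    · rw [C.star_fst hp]; linarith
    · rw [Set.mem_preimage, C.star_fst hp]; exact hzp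
  have key : volume.real S ≤ F.card * volume.real D := by
    calc volume.real S
        ≤ volume.real (⋃ x ∈ F, (fun z => z - (x, C.star x)) ⁻¹' D) := by
          refine measureReal_mono hsub ?_
          refine ((measure_biUnion_finset_le F _).trans_lt ?_).ne
          rw [Finset.sum_congr rfl hvol]
          exact ENNReal.sum_lt_top.2 fun _ _ => hDfin.lt_top
      _ ≤ ∑ x ∈ F, volume.real ((fun z => z - (x, C.star x)) ⁻¹' D) :=
          measureReal_biUnion_finset_le F _
      _ = F.card * volume.real D := by
          simp only [Measure.real]
          rw [Finset.sum_congr rfl fun x hx => congrArg ENNReal.toReal (hvol x hx)]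
          simp
  rw [div_mul_eq_mul_div, div_le_iff₀ hD0, ← hSvol]
  exact key

end CutAndProject

/-! ### Sums over the star image and translations -/

namespace CutAndProject

variable {m n : ℕ} (C : CutAndProject m n)

/-- The points of `L` in the ball of radius `s` whose image under the star map lies in the ball of
radius `R`. -/
noncomputable def points (R s : ℝ) : Finset (Euc m) :=
  (C.finite_truncate_modelSet (Metric.isBounded_closedBall (x := (0 : Euc n)) (r := R)) s).toFinset

lemma mem_points {R s : ℝ} {x : Euc m} :
    x ∈ C.points R s ↔ x ∈ C.L ∧ ‖C.star x‖ ≤ R ∧ ‖x‖ ≤ s := by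
  simp only [points, truncate, modelSet, Set.Finite.mem_toFinset, Set.mem_ofPred_eq,
    mem_closedBall_zero_iff, and_assoc]

lemma exists_card_points_le (R : ℝ) : ∃ c : ℝ, 0 ≤ c ∧
    ∀ᶠ s : ℝ in atTop, ((C.points R s).card : ℝ) ≤ c * s ^ m := by
  obtain ⟨c, r, hr0, hc0, h⟩ := C.exists_card_shell_le R
  set v := volume.real (Metric.ball (0 : Euc m) 1) with hv
  refine ⟨c * 2 ^ m * v, by positivity, ?_⟩
  filter_upwards [eventually_ge_atTop r] with s hs
  -- a shell with negative inner radius is a full ball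
  have hneg : Metric.closedBall (0 : Euc m) (-r - 1) = ∅ :=
    Metric.closedBall_eq_empty.2 (by linarith)
  have := h (C.points R s) s (-r - 1) (by linarith) fun x hx => by
    obtain ⟨h1, h2, h3⟩ := C.mem_points.1 hx
    exact ⟨h1, by linarith [norm_nonneg x], h3, h2⟩
  rw [hneg, measureReal_empty, sub_zero, volume_real_closedBall (by linarith)] at this
  calc _ ≤ c * ((s + r) ^ m * v) := this
    _ ≤ c * ((2 * s) ^ m * v) := by gcongr <;> linarith
    _ = c * 2 ^ m * v * s ^ m := by rw [mul_pow]; ring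

/-- The lattice points in a spherical shell of bounded thickness are negligible. -/
lemma exists_card_shell_isLittleO (R ρ : ℝ) : ∃ g : ℝ → ℝ, Tendsto g atTop (𝓝 0) ∧
    ∀ᶠ s : ℝ in atTop, ∀ F : Finset (Euc m),
      (∀ x ∈ F, x ∈ C.L ∧ s - ρ < ‖x‖ ∧ ‖x‖ ≤ s + ρ ∧ ‖C.star x‖ ≤ R) →
      (F.card : ℝ) ≤ g s * s ^ m := by
  obtain ⟨c, r, hr0, hc0, h⟩ := C.exists_card_shell_le R
  set v := volume.real (Metric.ball (0 : Euc m) 1) with hv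
  refine ⟨fun s => |c * v * ((1 + (ρ + r) * s⁻¹) ^ m - (1 - (ρ + r) * s⁻¹) ^ m)|, ?_, ?_⟩
  · have h0 : Tendsto (fun s : ℝ => (ρ + r) * s⁻¹) atTop (𝓝 0) := by
      simpa using tendsto_inv_atTop_zero.const_mul (ρ + r)
    simpa using ((((h0.const_add 1).pow m).sub ((h0.const_sub 1).pow m)).const_mul (c * v)).abs
  · filter_upwards [eventually_gt_atTop 0, eventually_ge_atTop (ρ + r),
      eventually_ge_atTop (-(ρ + r))] with s hs0 hs1 hs2 F hF
    have hs3 : s ≠ 0 := hs0.ne'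
    by_cases hne : F.Nonempty
    · obtain ⟨x, hx⟩ := hne
      have hρ : 0 < ρ := by linarith [(hF x hx).2.1, (hF x hx).2.2.1]
      have := h F (s + ρ) (s - (ρ + r)) (by linarith) fun x hx => by
        obtain ⟨h1, h2, h3, h4⟩ := hF x hx
        exact ⟨h1, by linarith, h3, h4⟩
      rw [volume_real_closedBall (by linarith), volume_real_closedBall (by linarith), ← hv] at this
      refine this.trans (le_trans (le_of_eq ?_)
        (mul_le_mul_of_nonneg_right (le_abs_self _) (by positivity)))
      have e1 : s + ρ + r = (1 + (ρ + r) * s⁻¹) * s := by field_simp; ring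
      have e2 : s - (ρ + r) = (1 - (ρ + r) * s⁻¹) * s := by field_simp
      rw [e1, e2, mul_pow, mul_pow]
      ring
    · rw [Finset.not_nonempty_iff_eq_empty.1 hne, Finset.card_empty, Nat.cast_zero]
      positivity

lemma exists_le_card_points : ∃ c R : ℝ, 0 < c ∧
    ∀ᶠ s : ℝ in atTop, c * s ^ m ≤ (C.points R s).card := by
  obtain ⟨c, R, r, hc, hr, h⟩ := C.exists_le_card_truncate
  refine ⟨c * (1 / 2) ^ m, R, by positivity, ?_⟩
  filter_upwards [eventually_ge_atTop (2 * r)] with s hs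
  refine le_trans ?_ (h s (by linarith) _ fun x hx h1 h2 => C.mem_points.2 ⟨hx, h2, h1⟩)
  rw [mul_assoc, ← mul_pow]
  gcongr <;> linarith

/-- The sum of `φ (x*)` over the points `x` of `L` in the ball of radius `s`; for `φ` of compact
support it has finitely many non-zero terms. -/
noncomputable def starSum (φ : Euc n → ℝ) (s : ℝ) : ℝ := ∑ᶠ x ∈ truncate C.L s, φ (C.star x)

lemma starSum_eq_sum {φ : Euc n → ℝ} {R : ℝ} (hφ : ∀ y, R < ‖y‖ → φ y = 0) (s : ℝ) :
    C.starSum φ s = ∑ x ∈ C.points R s, φ (C.star x) := by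
  refine finsum_mem_eq_sum_of_inter_support_eq _ ?_
  ext x
  simp only [Set.mem_inter_iff, Function.mem_support, Finset.mem_coe, mem_points, truncate,
    Set.mem_ofPred_eq]
  constructor
  · rintro ⟨⟨h1, h2⟩, h3⟩
    exact ⟨⟨h1, not_lt.1 fun h => h3 (hφ _ h), h2⟩, h3⟩
  · rintro ⟨⟨h1, h2, h3⟩, h4⟩
    exact ⟨⟨h1, h3⟩, h4⟩

lemma exists_radius {φ : Euc n → ℝ} (hφ : HasCompactSupport φ) :
    ∃ R : ℝ, 0 < R ∧ ∀ y, R < ‖y‖ → φ y = 0 := by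
  obtain ⟨R, hR0, hR⟩ := hφ.isCompact.isBounded.exists_pos_norm_le
  refine ⟨R, hR0, fun y hy => ?_⟩
  by_contra h
  exact absurd (hR y (subset_tsupport φ h)) (not_le.2 hy)

lemma abs_sum_sub_sum_le {α : Type*} (P P' : Finset α) (f : α → ℝ) {M : ℝ}
    (hM : 0 ≤ M) (hf : ∀ x, |f x| ≤ M) {g : ℝ} (hg : ∀ F : Finset α,
      (∀ x ∈ F, (x ∈ P ∧ x ∉ P') ∨ (x ∈ P' ∧ x ∉ P)) → (F.card : ℝ) ≤ g) :
    |∑ x ∈ P, f x - ∑ x ∈ P', f x| ≤ 2 * (M * g) := by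
  classical
  have h1 : ∀ F : Finset α, (∀ x ∈ F, (x ∈ P ∧ x ∉ P') ∨ (x ∈ P' ∧ x ∉ P)) →
      |∑ x ∈ F, f x| ≤ M * g := fun F hF => by
    calc |∑ x ∈ F, f x| ≤ ∑ x ∈ F, |f x| := Finset.abs_sum_le_sum_abs _ _
      _ ≤ ∑ x ∈ F, M := Finset.sum_le_sum fun x _ => hf x
      _ = M * F.card := by simp [mul_comm]
      _ ≤ M * g := by gcongr; exact hg F hF
  rw [← Finset.sum_sdiff_sub_sum_sdiff, two_mul]
  refine (abs_sub _ _).trans (add_le_add (h1 _ ?_) (h1 _ ?_))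
  · intro x hx; exact Or.inl (Finset.mem_sdiff.1 hx)
  · intro x hx; exact Or.inr (Finset.mem_sdiff.1 hx)

/-- Since `L*` is dense, translating the function by any vector of internal space does not change
the sums over large balls, up to lower order: translations by `L*` only change the sum by the
contribution of a shell. -/
lemma tendsto_starSum_translate_sub {φ : Euc n → ℝ} (hφ : Continuous φ) (hc : HasCompactSupport φ)
    (t : Euc n) :
    Tendsto (fun s => (C.starSum (fun y => φ (y - t)) s - C.starSum φ s) / s ^ m)
      atTop (𝓝 0) := by
  obtain ⟨r, hr0, hr⟩ := exists_radius hc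
  obtain ⟨M, hM⟩ := hc.exists_bound_of_continuous hφ
  set R := r + ‖t‖ + 1 with hR
  obtain ⟨c, hc0, hcard⟩ := C.exists_card_points_le R
  rw [Metric.tendsto_nhds]
  intro η hη
  obtain ⟨δ, hδ0, hδ⟩ := Metric.uniformContinuous_iff.1
    (hc.uniformContinuous_of_continuous hφ) (η / (2 * (c + 1))) (by positivity)
  obtain ⟨_, ⟨x₀, hx₀, rfl⟩, hd⟩ := C.dense_star_image.exists_dist_lt t (lt_min hδ0 one_pos)
  obtain ⟨hd1, hd2⟩ := lt_min_iff.1 hd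
  obtain ⟨g, hg, hshell⟩ := C.exists_card_shell_isLittleO R ‖x₀‖
  have hMg : Tendsto (fun s => 2 * (M * g s)) atTop (𝓝 0) := by
    simpa using (hg.const_mul M).const_mul 2
  filter_upwards [hcard, hshell, eventually_gt_atTop 0,
    hMg.eventually (gt_mem_nhds (half_pos hη))] with s h1 h2 h3 h4
  have hs : 0 < s ^ m := by positivity
  have hx₀R : ‖C.star x₀‖ ≤ ‖t‖ + 1 := by
    have := norm_sub_norm_le (C.star x₀) t
    rw [← dist_eq_norm, dist_comm] at this
    linarith
  have e1 : C.starSum (fun y => φ (y - t)) s = ∑ x ∈ C.points R s, φ (C.star x - t) := by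
    refine C.starSum_eq_sum (fun y hy => hr _ ?_) s
    have := norm_sub_norm_le y t
    linarith
  have e2 : C.starSum φ s = ∑ x ∈ (C.points (R + ‖C.star x₀‖) s).image (· + x₀) with
      ‖C.star x‖ ≤ R, φ (C.star x - C.star x₀) := by
    rw [Finset.sum_filter, Finset.sum_image (fun a _ b _ h => add_right_cancel h),
      C.starSum_eq_sum (R := R + ‖C.star x₀‖)
        (fun y hy => hr _ (by linarith [norm_nonneg (C.star x₀), norm_nonneg t]))]
    refine Finset.sum_congr rfl fun x hx => ?_
    have hxL := (C.mem_points.1 hx).1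
    rw [C.star_add hxL hx₀, add_sub_cancel_right]
    split_ifs with h
    · rfl
    · refine hr _ ?_
      have := norm_add_le (C.star x) (C.star x₀)
      linarith [not_le.1 h]
  have e3 : |∑ x ∈ C.points R s, φ (C.star x - t) -
      ∑ x ∈ C.points R s, φ (C.star x - C.star x₀)| ≤ (η / (2 * (c + 1))) * (c * s ^ m) := by
    rw [← Finset.sum_sub_distrib]
    calc _ ≤ ∑ x ∈ C.points R s, |φ (C.star x - t) - φ (C.star x - C.star x₀)| :=
          Finset.abs_sum_le_sum_abs _ _
      _ ≤ ∑ x ∈ C.points R s, η / (2 * (c + 1)) := by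
          refine Finset.sum_le_sum fun x _ => ?_
          rw [← Real.dist_eq]
          refine (hδ ?_).le
          rw [dist_sub_left]
          exact hd1
      _ = (η / (2 * (c + 1))) * (C.points R s).card := by simp [mul_comm]
      _ ≤ _ := by gcongr
  have e4 := abs_sum_sub_sum_le (C.points R s)
    {x ∈ (C.points (R + ‖C.star x₀‖) s).image (· + x₀) | ‖C.star x‖ ≤ R}
    (fun x => φ (C.star x - C.star x₀)) ((norm_nonneg _).trans (hM 0)) (fun x => hM _)
    (g := g s * s ^ m)
    (fun F hF => h2 F fun x hx => by
      rcases hF x hx with ⟨ha, hb⟩ | ⟨ha, hb⟩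
      · obtain ⟨ha1, ha2, ha3⟩ := C.mem_points.1 ha
        refine ⟨ha1, ?_, by linarith [norm_nonneg x₀], ha2⟩
        by_contra hcon
        refine hb (Finset.mem_filter.2 ⟨Finset.mem_image.2 ⟨x - x₀, C.mem_points.2
          ⟨C.sub_mem_L ha1 hx₀, ?_, ?_⟩, sub_add_cancel _ _⟩, ha2⟩)
        · rw [C.star_sub ha1 hx₀]
          exact (norm_sub_le _ _).trans (by linarith)
        · have := norm_sub_le x x₀
          linarith [not_lt.1 hcon]
      · obtain ⟨ha1, ha2⟩ := Finset.mem_filter.1 ha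
        obtain ⟨y, hy, rfl⟩ := Finset.mem_image.1 ha1
        obtain ⟨hy1, hy2, hy3⟩ := C.mem_points.1 hy
        have hL := C.add_mem_L hy1 hx₀
        refine ⟨hL, ?_, (norm_add_le _ _).trans (by linarith), ha2⟩
        by_contra hcon
        exact hb (C.mem_points.2 ⟨hL, ha2, by linarith [not_lt.1 hcon, norm_nonneg x₀]⟩))
  rw [← e2] at e4
  rw [dist_zero_right, Real.norm_eq_abs, abs_div, abs_of_pos hs, div_lt_iff₀ hs, e1]
  have e5 : η / (2 * (c + 1)) * (c * s ^ m) ≤ η / 2 * s ^ m := by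
    have : η / (2 * (c + 1)) * c ≤ η / 2 := by
      rw [div_mul_eq_mul_div, div_le_div_iff₀ (by positivity) two_pos]
      nlinarith
    nlinarith
  calc _ ≤ |∑ x ∈ C.points R s, φ (C.star x - t) -
      ∑ x ∈ C.points R s, φ (C.star x - C.star x₀)| +
      |∑ x ∈ C.points R s, φ (C.star x - C.star x₀) - C.starSum φ s| := abs_sub_le _ _ _
    _ ≤ η / 2 * s ^ m + 2 * (M * g s) * s ^ m := by
      refine add_le_add (e3.trans e5) (e4.trans (le_of_eq (by ring)))
    _ < η / 2 * s ^ m + η / 2 * s ^ m := by gcongr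
    _ = η * s ^ m := by ring

end CutAndProject

/-! ### Uniform distribution of model sets -/

namespace CutAndProject

variable {m n : ℕ} (C : CutAndProject m n)

lemma tendsto_starSum_convolution {φ ψ : Euc n → ℝ} (hφ : Continuous φ)
    (hφc : HasCompactSupport φ) (hψ : Continuous ψ) (hψc : HasCompactSupport ψ) :
    Tendsto (fun s => (C.starSum (fun y => ∫ t, φ (y - t) * ψ t) s -
      C.starSum φ s * ∫ t, ψ t) / s ^ m) atTop (𝓝 0) := by
  obtain ⟨r, hr0, hr⟩ := exists_radius hφc
  obtain ⟨r', hr0', hr'⟩ := exists_radius hψc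
  obtain ⟨M, hM⟩ := hφc.exists_bound_of_continuous hφ
  set R := r + r' with hR
  obtain ⟨c, hc0, hcard⟩ := C.exists_card_points_le R
  have hint : ∀ y, Integrable (fun t => φ (y - t) * ψ t) := fun y =>
    (by fun_prop : Continuous fun t => φ (y - t) * ψ t).integrable_of_hasCompactSupport
      hψc.mul_left
  have hψint : Integrable ψ := hψ.integrable_of_hasCompactSupport hψc
  have hconv : ∀ s, C.starSum (fun y => ∫ t, φ (y - t) * ψ t) s =
      ∑ x ∈ C.points R s, ∫ t, φ (C.star x - t) * ψ t := fun s => by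
    refine C.starSum_eq_sum (fun y hy => ?_) s
    refine integral_eq_zero_of_ae (Eventually.of_forall fun t => ?_)
    by_cases ht : r' < ‖t‖
    · simp [hr' t ht]
    · have := norm_sub_norm_le y t
      simp [hr (y - t) (by linarith)]
  have hφs : ∀ s, C.starSum φ s = ∑ x ∈ C.points R s, φ (C.star x) := fun s =>
    C.starSum_eq_sum (fun y hy => hr _ (by linarith)) s
  set F : ℝ → Euc n → ℝ := fun s t =>
    (∑ x ∈ C.points R s, φ (C.star x - t) - ∑ x ∈ C.points R s, φ (C.star x)) / s ^ m * ψ t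
    with hF
  have hFint : ∀ s, (C.starSum (fun y => ∫ t, φ (y - t) * ψ t) s -
      C.starSum φ s * ∫ t, ψ t) / s ^ m = ∫ t, F s t := fun s => by
    have : ∀ t, F s t = (∑ x ∈ C.points R s, φ (C.star x - t) * ψ t -
        C.starSum φ s * ψ t) / s ^ m := fun t => by
      rw [hF, hφs, ← Finset.sum_mul]; ring
    simp_rw [this]
    rw [integral_div, integral_sub (integrable_finsetSum _ fun x _ => hint _)
      (hψint.const_mul _), integral_finsetSum _ fun x _ => hint _, integral_const_mul, hconv]
  simp_rw [hFint]
  have hM0 : 0 ≤ M := (norm_nonneg _).trans (hM 0)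
  have hsum : ∀ s t, |∑ x ∈ C.points R s, φ (C.star x - t)| ≤ M * (C.points R s).card :=
    fun s t => by
      refine (Finset.abs_sum_le_sum_abs _ _).trans
        ((Finset.sum_le_sum fun x _ => hM _).trans (le_of_eq ?_))
      simp [mul_comm]
  have hlim := tendsto_integral_filter_of_dominated_convergence (μ := volume) (l := atTop)
    (F := F) (f := fun _ => 0) (fun t => 2 * M * c * |ψ t|) ?_ ?_ ?_ ?_
  · simpa using hlim
  · refine Eventually.of_forall fun s => Continuous.aestronglyMeasurable ?_
    simp only [hF]
    fun_prop
  · filter_upwards [hcard, eventually_gt_atTop 0] with s hs hs0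
    refine Eventually.of_forall fun t => ?_
    have hsm : 0 < s ^ m := by positivity
    rw [hF, Real.norm_eq_abs, abs_mul]
    refine mul_le_mul_of_nonneg_right ?_ (abs_nonneg _)
    rw [abs_div, abs_of_pos hsm, div_le_iff₀ hsm]
    have h0 := hsum s 0
    simp only [sub_zero] at h0
    calc _ ≤ M * (C.points R s).card + M * (C.points R s).card :=
          (abs_sub _ _).trans (add_le_add (hsum s t) h0)
      _ ≤ M * (c * s ^ m) + M * (c * s ^ m) := by gcongr
      _ = _ := by ring
  · exact hψint.abs.const_mul _
  · refine Eventually.of_forall fun t => ?_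
    by_cases ht : r' < ‖t‖
    · simp [hF, hr' t ht]
    · have h := (C.tendsto_starSum_translate_sub hφ hφc t).mul_const (ψ t)
      rw [zero_mul] at h
      refine h.congr fun s => ?_
      rw [hF, hφs, C.starSum_eq_sum (R := R) (fun y hy => hr _ ?_)]
      have := norm_sub_norm_le y t
      linarith

/-- The sums over `L` of two test functions on internal space are asymptotically proportional to
their integrals: the convolution of the two functions compares to either of them. -/
lemma tendsto_starSum_mul_integral_sub {φ ψ : Euc n → ℝ} (hφ : Continuous φ)
    (hφc : HasCompactSupport φ) (hψ : Continuous ψ) (hψc : HasCompactSupport ψ) :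
    Tendsto (fun s => (C.starSum φ s * (∫ t, ψ t) - C.starSum ψ s * ∫ t, φ t) / s ^ m)
      atTop (𝓝 0) := by
  have h1 := C.tendsto_starSum_convolution hφ hφc hψ hψc
  have h2 := C.tendsto_starSum_convolution hψ hψc hφ hφc
  have hcomm : (fun y => ∫ t, ψ (y - t) * φ t) = fun y => ∫ t, φ (y - t) * ψ t := by
    funext y
    rw [← integral_sub_left_eq_self _ volume y]
    simp [mul_comm]
  rw [hcomm] at h2
  have := h2.sub h1
  rw [sub_zero] at this
  refine this.congr fun s => ?_
  ring

/-- **Uniform distribution** of `L*` for continuous test functions of compact support, with an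
unspecified normalization. -/
lemma exists_normalization : ∃ M : ℝ → ℝ, (∀ᶠ s in atTop, 0 < M s) ∧
    ∀ φ : Euc n → ℝ, Continuous φ → HasCompactSupport φ →
      Tendsto (fun s => C.starSum φ s / M s) atTop (𝓝 (∫ y, φ y)) := by
  obtain ⟨c, R, hc, hcard⟩ := C.exists_le_card_points
  obtain ⟨ψ, hψ1, -, hψc, hψ01⟩ := exists_continuous_one_zero_of_isCompact
    (isCompact_closedBall (0 : Euc n) (max R 1)) isClosed_empty (Set.disjoint_empty _)
  have hψint : 0 < ∫ y, ψ y := by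
    rw [integral_pos_iff_support_of_nonneg (fun y => (hψ01 y).1)
      (ψ.continuous.integrable_of_hasCompactSupport hψc)]
    refine (Metric.measure_ball_pos volume (0 : Euc n) one_pos).trans_le (measure_mono ?_)
    intro y hy
    have : ψ y = 1 := hψ1 (Metric.closedBall_subset_closedBall (le_max_right _ _)
      (Metric.ball_subset_closedBall hy))
    simp [this]
  have hlow : ∀ᶠ s : ℝ in atTop, c * s ^ m ≤ C.starSum ψ s := by
    filter_upwards [hcard] with s hs
    refine hs.trans ?_
    obtain ⟨r, hr0, hr⟩ := exists_radius hψc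
    rw [C.starSum_eq_sum (R := max R r) (fun y hy => hr _ ((le_max_right _ _).trans_lt hy))]
    rw [Finset.cast_card]
    refine (Finset.sum_le_sum (fun x hx => ?_)).trans
      (Finset.sum_le_sum_of_subset_of_nonneg (f := fun x => ψ (C.star x)) (s := C.points R s) ?_
        (fun x _ _ => (hψ01 _).1))
    · refine (hψ1 ?_).ge
      rw [mem_closedBall_zero_iff]
      exact (C.mem_points.1 hx).2.1.trans (le_max_left _ _)
    · intro x hx
      obtain ⟨h1, h2, h3⟩ := C.mem_points.1 hx
      exact C.mem_points.2 ⟨h1, h2.trans (le_max_left _ _), h3⟩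
  refine ⟨fun s => C.starSum ψ s / ∫ y, ψ y, ?_, fun φ hφ hφc => ?_⟩
  · filter_upwards [hlow, eventually_gt_atTop 0] with s hs hs0
    have : 0 < c * s ^ m := by positivity
    exact div_pos (this.trans_le hs) hψint
  · rw [tendsto_iff_norm_sub_tendsto_zero]
    have h := (C.tendsto_starSum_mul_integral_sub hφ hφc ψ.continuous hψc).norm.const_mul c⁻¹
    rw [norm_zero, mul_zero] at h
    refine squeeze_zero' (Eventually.of_forall fun s => norm_nonneg _) ?_ h
    filter_upwards [hlow, eventually_gt_atTop 0] with s hs hs0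
    have hsm : 0 < s ^ m := by positivity
    have hpos : 0 < C.starSum ψ s := (mul_pos hc hsm).trans_le hs
    have : C.starSum φ s / (C.starSum ψ s / ∫ y, ψ y) - ∫ y, φ y =
        (C.starSum φ s * (∫ y, ψ y) - C.starSum ψ s * ∫ y, φ y) / C.starSum ψ s := by
      field_simp
    rw [this, norm_div, norm_div, Real.norm_of_nonneg hpos.le, Real.norm_of_nonneg hsm.le,
      inv_mul_eq_div, div_div, mul_comm (s ^ m)]
    gcongr

lemma finsum_truncate_modelSet (W : Set (Euc n)) (h : Euc n → ℝ) (s : ℝ) :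
    ∑ᶠ x ∈ truncate (C.modelSet W) s, h (C.star x) = C.starSum (W.indicator h) s := by
  classical
  refine finsum_congr fun x => ?_
  by_cases hx : x ∈ truncate C.L s
  · by_cases hW : C.star x ∈ W
    · have : x ∈ truncate (C.modelSet W) s := ⟨⟨hx.1, hW⟩, hx.2⟩
      simp [hx, this, hW]
    · have : x ∉ truncate (C.modelSet W) s := fun h => hW h.1.2
      simp [this, hW]
  · have : x ∉ truncate (C.modelSet W) s := fun h => hx ⟨h.1.1, h.2⟩
    simp [hx, this]

/-- Continuous functions of compact support squeezing the indicator function of a compact set with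
null boundary. -/
lemma exists_continuous_between {d : ℕ} {W : Set (Euc d)} (hW : IsCompact W)
    (hW0 : volume (frontier W) = 0) {ε : ℝ} (hε : 0 < ε) : ∃ u w : Euc d → ℝ,
    Continuous u ∧ HasCompactSupport u ∧ Continuous w ∧ HasCompactSupport w ∧
    (∀ y, 0 ≤ u y) ∧ (∀ y, u y ≤ w y) ∧ (∀ y ∈ W, w y = 1) ∧
    (∀ y ∉ W, u y = 0) ∧ (∀ y ∉ Metric.cthickening 1 W, w y = 0) ∧
    (∫ y, (w y - u y)) < ε := by
  have hε2 : 0 < ENNReal.ofReal (ε / 2) := by simpa using hε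
  obtain ⟨V, hWV, hVo, hV⟩ := hW.exists_isOpen_lt_add (μ := volume) hε2.ne'
  have hintW : volume (interior W) = volume W := measure_interior_of_null_frontier hW0
  have hWfin : volume W ≠ ⊤ := hW.measure_lt_top.ne
  obtain ⟨K, hKW, hK, hKlt⟩ := isOpen_interior.measurableSet.exists_isCompact_lt_add (μ := volume)
    (hintW ▸ hWfin) hε2.ne'
  rw [hintW] at hKlt
  obtain ⟨w, hw1, hw0, hwc, hw01⟩ := exists_continuous_one_zero_of_isCompact hW
    (hVo.inter (Metric.isOpen_thickening (δ := 1) (E := W))).isClosed_compl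
    (Set.disjoint_compl_right_iff_subset.2
      (Set.subset_inter hWV (Metric.self_subset_thickening one_pos W)))
  obtain ⟨u, hu1, hu0, huc, hu01⟩ := exists_continuous_one_zero_of_isCompact hK
    (isOpen_interior (s := W)).isClosed_compl (Set.disjoint_compl_right_iff_subset.2 hKW)
  have hu0' : ∀ y ∉ W, u y = 0 := fun y hy => hu0 fun h => hy (interior_subset h)
  have hwi := w.continuous.integrable_of_hasCompactSupport (μ := volume) hwc
  have hui := u.continuous.integrable_of_hasCompactSupport (μ := volume) huc
  refine ⟨u, w, u.continuous, huc, w.continuous, hwc, fun y => (hu01 y).1,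
    fun y => ?_, fun y hy => hw1 hy, hu0', fun y hy => hw0 fun h =>
      hy (Metric.thickening_subset_cthickening _ _ h.2), ?_⟩
  · by_cases hy : y ∈ W
    · rw [hw1 hy]; exact (hu01 y).2
    · rw [hu0' y hy]; exact (hw01 y).1
  · rw [integral_sub hwi hui]
    have hVfin : volume V ≠ ⊤ := (hV.trans (ENNReal.add_lt_top.2
      ⟨hWfin.lt_top, ENNReal.ofReal_lt_top⟩)).ne
    have hKfin : volume K ≠ ⊤ := hK.measure_lt_top.ne
    have h1 : ∫ y, w y ≤ volume.real V := by
      rw [← integral_indicator_one hVo.measurableSet]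
      refine integral_mono hwi ((integrable_indicator_iff hVo.measurableSet).2
        (integrableOn_const hVfin)) fun y => ?_
      by_cases hy : y ∈ V
      · simpa [hy] using (hw01 y).2
      · have : w y = 0 := hw0 fun h => hy h.1
        simp [hy, this]
    have h2 : volume.real K ≤ ∫ y, u y := by
      rw [← integral_indicator_one hK.measurableSet]
      refine integral_mono ((integrable_indicator_iff hK.measurableSet).2
        (integrableOn_const hKfin)) hui fun y => ?_
      by_cases hy : y ∈ K
      · simp [hy, hu1 hy]
      · simpa [hy] using (hu01 y).1
    have h3 : volume V < volume K + ENNReal.ofReal ε := by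
      refine hV.trans_le ?_
      have : ENNReal.ofReal ε = ENNReal.ofReal (ε / 2) + ENNReal.ofReal (ε / 2) := by
        rw [← ENNReal.ofReal_add (by positivity) (by positivity), add_halves]
      rw [this, ← add_assoc]
      gcongr
    have h4 : volume.real V < volume.real K + ε := by
      have := ENNReal.toReal_strict_mono (ENNReal.add_ne_top.2 ⟨hKfin, ENNReal.ofReal_ne_top⟩) h3
      rwa [ENNReal.toReal_add hKfin ENNReal.ofReal_ne_top, ENNReal.toReal_ofReal hε.le] at this
    linarith

/-- Uniform distribution of `L*` extends from test functions to continuous functions cut off at a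
compact set with null boundary. -/
lemma tendsto_starSum_indicator {M : ℝ → ℝ} (hM : ∀ᶠ s in atTop, 0 < M s)
    (hlim : ∀ φ : Euc n → ℝ, Continuous φ → HasCompactSupport φ →
      Tendsto (fun s => C.starSum φ s / M s) atTop (𝓝 (∫ y, φ y)))
    {W : Set (Euc n)} (hW : IsCompact W) (hW0 : volume (frontier W) = 0)
    {h : Euc n → ℝ} (hh : Continuous h) :
    Tendsto (fun s => C.starSum (W.indicator h) s / M s) atTop (𝓝 (∫ y in W, h y)) := by
  have hW1 : IsCompact (Metric.cthickening 1 W) := hW.cthickening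
  obtain ⟨H, hH⟩ := hW1.exists_bound_of_continuousOn hh.continuousOn
  obtain ⟨R, hR⟩ := hW1.isBounded.exists_norm_le
  have hsub : W ⊆ Metric.cthickening 1 W := Metric.self_subset_cthickening W
  rw [Metric.tendsto_nhds]
  intro η hη
  obtain ⟨u, w, hu, huc, hw, hwc, hu0, huw, hwW, huW, hwV, hint⟩ :=
    exists_continuous_between hW hW0 (ε := η / (3 * (|H| + 1))) (by positivity)
  have hwu := hlim (fun y => w y - u y) (hw.sub hu) (hwc.sub huc)
  have hhw := hlim (fun y => h y * w y) (hh.mul hw) hwc.mul_left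
  have hwui : Integrable (fun y => w y - u y) :=
    (hw.sub hu).integrable_of_hasCompactSupport (hwc.sub huc)
  have hhwi : Integrable (fun y => h y * w y) :=
    (hh.mul hw).integrable_of_hasCompactSupport hwc.mul_left
  -- off the gap between `u` and `w`, replacing the indicator function by `w` changes nothing
  have hpt : ∀ y, |W.indicator h y - h y * w y| ≤ |H| * (w y - u y) := fun y => by
    by_cases hy : y ∈ W
    · rw [Set.indicator_of_mem hy, hwW y hy, mul_one, sub_self, abs_zero]
      have := huw y
      rw [hwW y hy] at this
      exact mul_nonneg (abs_nonneg _) (by linarith)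
    · rw [Set.indicator_of_notMem hy, zero_sub, abs_neg, huW y hy, sub_zero]
      by_cases hy1 : y ∈ Metric.cthickening 1 W
      · rw [abs_mul, abs_of_nonneg ((hu0 y).trans (huw y))]
        exact mul_le_mul_of_nonneg_right ((hH y hy1).trans (le_abs_self _))
          ((hu0 y).trans (huw y))
      · simp [hwV y hy1]
  have hI : |(∫ y in W, h y) - ∫ y, h y * w y| ≤ |H| * (η / (3 * (|H| + 1))) := by
    rw [← integral_indicator hW.measurableSet, ← integral_sub
      ((hh.continuousOn.integrableOn_compact hW).integrable_indicator hW.measurableSet) hhwi]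
    refine (abs_integral_le_integral_abs).trans ?_
    calc _ ≤ ∫ y, |H| * (w y - u y) := integral_mono_of_nonneg
          (Eventually.of_forall fun y => abs_nonneg _) (hwui.const_mul _)
          (Eventually.of_forall hpt)
      _ = |H| * ∫ y, (w y - u y) := integral_const_mul _ _
      _ ≤ _ := by gcongr
  have hS : ∀ s, |C.starSum (W.indicator h) s - C.starSum (fun y => h y * w y) s| ≤
      |H| * C.starSum (fun y => w y - u y) s := fun s => by
    have hz : ∀ y, R < ‖y‖ → y ∉ Metric.cthickening 1 W := fun y hy h1 => absurd (hR y h1) hy.not_ge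
    rw [C.starSum_eq_sum (R := R) (φ := W.indicator h)
        (fun y hy => Set.indicator_of_notMem (fun h => hz y hy (hsub h)) _),
      C.starSum_eq_sum (R := R) (φ := fun y => h y * w y) (fun y hy => by simp [hwV y (hz y hy)]),
      C.starSum_eq_sum (R := R) (φ := fun y => w y - u y) (fun y hy => by
        rw [hwV y (hz y hy), huW y fun h => hz y hy (hsub h), sub_zero]),
      ← Finset.sum_sub_distrib, Finset.mul_sum]
    exact (Finset.abs_sum_le_sum_abs _ _).trans (Finset.sum_le_sum fun x _ => hpt _)
  have hHη : |H| * (η / (3 * (|H| + 1))) < η / 3 := by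
    rw [mul_div_assoc', div_lt_div_iff₀ (by positivity) (by positivity)]
    nlinarith [abs_nonneg H]
  have hlim2 := (hwu.const_mul |H|).eventually_lt_const
    ((mul_le_mul_of_nonneg_left hint.le (abs_nonneg H)).trans_lt hHη)
  filter_upwards [hM, hlim2, Metric.tendsto_nhds.1 hhw (η / 3) (by positivity)] with s h1 h2 h3
  have h4 : |C.starSum (W.indicator h) s / M s - C.starSum (fun y => h y * w y) s / M s| <
      η / 3 := by
    rw [← sub_div, abs_div, abs_of_pos h1]
    refine lt_of_le_of_lt ?_ h2
    rw [mul_div_assoc']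
    gcongr
    exact hS s
  rw [Real.dist_eq] at h3 ⊢
  rw [abs_sub_comm] at hI
  calc _ ≤ _ := abs_sub_le _ (C.starSum (fun y => h y * w y) s / M s) _
    _ ≤ _ := add_le_add_right (abs_sub_le _ (∫ y, h y * w y) _) _
    _ < η / 3 + (η / 3 + η / 3) := by gcongr; exact hI.trans_lt hHη
    _ = η := by ring

/-- **Uniform distribution** of model sets: averages of a continuous function over the star image
of a model set converge to its mean over the window. -/
theorem tendsto_average_truncate_modelSet {W : Set (Euc n)} (hW : IsCompact W)
    (hW0 : volume (frontier W) = 0) (hWi : (interior W).Nonempty)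
    {h : Euc n → ℝ} (hh : Continuous h) :
    Tendsto (fun s => ((truncate (C.modelSet W) s).ncard : ℝ)⁻¹ *
      ∑ᶠ x ∈ truncate (C.modelSet W) s, h (C.star x)) atTop
      (𝓝 ((volume.real W)⁻¹ * ∫ y in W, h y)) := by
  obtain ⟨M, hM, hlim⟩ := C.exists_normalization
  have h1 := C.tendsto_starSum_indicator hM hlim hW hW0 hh
  have h2 := C.tendsto_starSum_indicator hM hlim hW hW0 (continuous_const (y := (1 : ℝ)))
  have hvol : ∫ _ in W, (1 : ℝ) = volume.real W := by simp
  have hpos : volume.real W ≠ 0 := (ENNReal.toReal_pos ((isOpen_interior.measure_pos volume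
    hWi).trans_le (measure_mono interior_subset)).ne' hW.measure_lt_top.ne).ne'
  rw [hvol] at h2
  refine ((h2.inv₀ hpos).mul h1).congr' ?_
  filter_upwards [hM] with s hs
  rw [← finsum_truncate_modelSet, ← finsum_truncate_modelSet]
  have hcard : ∑ᶠ x ∈ truncate (C.modelSet W) s, (1 : ℝ) =
      (truncate (C.modelSet W) s).ncard := by
    rw [finsum_mem_eq_finite_toFinset_sum _ (C.finite_truncate_modelSet hW.isBounded s),
      Set.ncard_eq_toFinset_card _ (C.finite_truncate_modelSet hW.isBounded s)]
    simp
  rw [hcard]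
  field_simp

lemma eventually_truncate_modelSet_nonempty {W : Set (Euc n)} (hWi : (interior W).Nonempty) :
    ∀ᶠ s in atTop, (truncate (C.modelSet W) s).Nonempty := by
  obtain ⟨_, hyW, x, hx, rfl⟩ := C.dense_star_image.inter_open_nonempty _ isOpen_interior hWi
  filter_upwards [eventually_ge_atTop ‖x‖] with s hs
  exact ⟨x, ⟨hx, interior_subset hyW⟩, hs⟩

end CutAndProject

/-! ### The determinant of the induced map and decay of its powers -/

namespace IsCompatibleSimilarity

variable {m n : ℕ} {C : CutAndProject m n} {Ω : Set (Euc n)} {Q : Euc m ≃ₗ[ℝ] Euc m}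
  {A : Euc n →ₗ[ℝ] Euc n}

lemma map_mem_L (hQ : IsCompatibleSimilarity C Ω Q A) {x : Euc m} (hx : x ∈ C.L) : Q x ∈ C.L :=
  hQ.image_L ▸ Set.mem_image_of_mem Q hx

lemma symm_mem_L (hQ : IsCompatibleSimilarity C Ω Q A) {x : Euc m} (hx : x ∈ C.L) :
    Q.symm x ∈ C.L := by
  rw [← hQ.image_L] at hx
  obtain ⟨y, hy, rfl⟩ := hx
  simpa using hy

/-- `Q × A` is an automorphism of the lattice, so its determinant is `±1`. -/
lemma abs_det_mul_abs_det (hQ : IsCompatibleSimilarity C Ω Q A) :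
    |LinearMap.det (Q : Euc m →ₗ[ℝ] Euc m)| * |LinearMap.det A| = 1 := by
  set T : Euc m × Euc n →ₗ[ℝ] Euc m × Euc n := (Q : Euc m →ₗ[ℝ] Euc m).prodMap A with hT
  have hmem : ∀ p ∈ C.lattice, T.restrictScalars ℤ p ∈ C.lattice := fun p hp => by
    have h := C.mk_star_mem (hQ.map_mem_L (C.fst_mem_L hp))
    rwa [hQ.star_map _ (C.fst_mem_L hp), C.star_fst hp] at h
  have hbij : Function.Bijective ((T.restrictScalars ℤ).restrict hmem) := by
    constructor
    · intro p q hpq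
      have h : Q p.1.1 = Q q.1.1 := congrArg (fun z : C.lattice => z.1.1) hpq
      exact Subtype.ext (C.injOn_fst p.2 q.2 (Q.injective h))
    · intro p
      have hL := hQ.symm_mem_L (C.fst_mem_L p.2)
      refine ⟨⟨_, C.mk_star_mem hL⟩, Subtype.ext (C.injOn_fst (hmem _ (C.mk_star_mem hL)) p.2 ?_)⟩
      change Q (Q.symm p.1.1) = p.1.1
      simp
  set e := LinearEquiv.ofBijective _ hbij
  set b := Module.Free.chooseBasis ℤ C.lattice
  classical
  set b₀ := b.ofZLatticeBasis ℝ C.lattice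
  have h1 := ZLattice.covolume_eq_det_mul_measureReal C.lattice b b₀ (μ := volume)
  have h2 := ZLattice.covolume_eq_det_mul_measureReal C.lattice (b.map e) b₀ (μ := volume)
  have h3 : ((↑) ∘ b.map e : _ → Euc m × Euc n) = T ∘ ((↑) ∘ b) := by
    funext i; rfl
  rw [h3, b₀.det_comp, abs_mul, mul_assoc, ← h1] at h2
  have h4 : |LinearMap.det T| = 1 :=
    mul_right_cancel₀ (ZLattice.covolume_ne_zero C.lattice volume) (by rw [← h2, one_mul])
  rwa [hT, LinearMap.det_prodMap, abs_mul] at h4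

lemma det_ne_zero (hQ : IsCompatibleSimilarity C Ω Q A) : LinearMap.det A ≠ 0 := fun h => by
  have := hQ.abs_det_mul_abs_det
  simp [h] at this

end IsCompatibleSimilarity

section Powers

open scoped NNReal

attribute [local instance] Matrix.linftyOpNormedRing Matrix.linftyOpNormedAlgebra in
/-- By Gelfand's formula, the powers of a complex matrix all of whose eigenvalues have modulus less
than one decay geometrically. -/
lemma exists_summable_matrix_pow {n : ℕ} (M : Matrix (Fin n) (Fin n) ℂ)
    (hM : ∀ z : ℂ, M.charpoly.IsRoot z → ‖z‖ < 1) :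
    ∃ a : ℕ → ℝ, Summable a ∧ ∀ N i j, ‖(M ^ N) i j‖ ≤ a N := by
  have : CompleteSpace (Matrix (Fin n) (Fin n) ℂ) := FiniteDimensional.complete ℂ _
  rcases isEmpty_or_nonempty (Fin n) with hn | hn
  · exact ⟨0, summable_zero, fun N i => hn.elim i⟩
  refine ⟨fun N => ‖M ^ N‖, ?_, fun N i j => ?_⟩
  · have hρ : spectralRadius ℂ M < ((1 : ℝ≥0) : ℝ≥0∞) :=
      spectrum.spectralRadius_lt_of_forall_lt M fun z hz => by
        exact_mod_cast hM z (Matrix.mem_spectrum_iff_isRoot_charpoly.1 hz)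
    obtain ⟨r, hr1, hr2⟩ := ENNReal.lt_iff_exists_nnreal_btwn.1 hρ
    have hr : (r : ℝ) < 1 := by exact_mod_cast hr2
    refine Summable.of_norm_bounded_eventually_nat (g := fun N => (r : ℝ) ^ N)
      (summable_geometric_of_lt_one r.2 hr) ?_
    filter_upwards [
      (spectrum.pow_nnnorm_pow_one_div_tendsto_nhds_spectralRadius M).eventually_lt_const hr1,
      eventually_gt_atTop 0] with N hN hN0
    rw [norm_norm]
    have h1 : (‖M ^ N‖₊ : ℝ≥0∞) < (r : ℝ≥0∞) ^ N := by
      have := ENNReal.rpow_lt_rpow hN (z := (N : ℝ)) (by exact_mod_cast hN0)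
      rwa [← ENNReal.rpow_mul, one_div, inv_mul_cancel₀ (by positivity), ENNReal.rpow_one,
        ENNReal.rpow_natCast] at this
    exact_mod_cast h1.le
  · have h := Matrix.linfty_opNorm_def (M ^ N)
    have h1 : ‖(M ^ N) i j‖₊ ≤ ∑ j, ‖(M ^ N) i j‖₊ :=
      Finset.single_le_sum (f := fun j => ‖(M ^ N) i j‖₊) (fun _ _ => zero_le) (Finset.mem_univ j)
    have h2 : ∑ j, ‖(M ^ N) i j‖₊ ≤ Finset.univ.sup fun i => ∑ j, ‖(M ^ N) i j‖₊ :=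
      Finset.le_sup (f := fun i => ∑ j, ‖(M ^ N) i j‖₊) (Finset.mem_univ i)
    exact le_of_le_of_eq (by exact_mod_cast h1.trans h2) h.symm

lemma exists_summable_adjoint_pow {n : ℕ} (A : Euc n →ₗ[ℝ] Euc n)
    (hA : ∀ z : ℂ, Polynomial.aeval z (LinearMap.charpoly A) = 0 → ‖z‖ < 1) :
    ∃ a : ℕ → ℝ, Summable a ∧ ∀ N k, ‖(LinearMap.adjoint A ^ N) k‖ ≤ a N * ‖k‖ := by
  set b := (EuclideanSpace.basisFun (Fin n) ℝ).toBasis with hb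
  set M := LinearMap.toMatrix b b A with hM
  obtain ⟨a, ha, hle⟩ := exists_summable_matrix_pow (M.map (algebraMap ℝ ℂ)) fun z hz => by
    refine hA z ?_
    rw [← LinearMap.charpoly_toMatrix A b, ← hM]
    change (Matrix.charpoly (M.map (algebraMap ℝ ℂ))).IsRoot z at hz
    rwa [Matrix.charpoly_map, Polynomial.IsRoot, Polynomial.eval_map_algebraMap] at hz
  have ha0 : ∀ (N : ℕ) (_ : Fin n), 0 ≤ a N := fun N i => (norm_nonneg _).trans (hle N i i)
  have hentry : ∀ N i j, |(LinearMap.toMatrix b b (A ^ N)) i j| ≤ a N := fun N i j => by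
    have := hle N i j
    rw [← Matrix.map_pow, Matrix.map_apply] at this
    rw [← LinearMap.toMatrix_pow, ← hM]
    simpa using this
  have hcoord : ∀ N y i, ((A ^ N) y) i = ∑ j, (LinearMap.toMatrix b b (A ^ N)) i j * y j :=
    fun N y i => by
      have := congrFun (LinearMap.toMatrix_mulVec_repr b b (A ^ N) y) i
      simpa [Matrix.mulVec, dotProduct, hb] using this.symm
  have hpow : ∀ N y, ‖(A ^ N) y‖ ≤ n * n * a N * ‖y‖ := fun N y => by
    have h1 : ∀ i, |((A ^ N) y) i| ≤ n * a N * ‖y‖ := fun i => by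
      rw [hcoord]
      calc _ ≤ ∑ j, |(LinearMap.toMatrix b b (A ^ N)) i j * y j| := Finset.abs_sum_le_sum_abs _ _
        _ ≤ ∑ j : Fin n, a N * ‖y‖ := by
          refine Finset.sum_le_sum fun j _ => ?_
          rw [abs_mul]
          exact mul_le_mul (hentry N i j) (PiLp.norm_apply_le y j) (abs_nonneg _) (ha0 N i)
        _ = _ := by simp [mul_assoc]
    have h2 : ‖(A ^ N) y‖ ≤ ∑ i, |((A ^ N) y) i| := by
      conv_lhs => rw [← (EuclideanSpace.basisFun (Fin n) ℝ).sum_repr ((A ^ N) y)]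
      refine (norm_sum_le _ _).trans (le_of_eq ?_)
      simp [norm_smul]
    calc _ ≤ _ := h2
      _ ≤ ∑ i : Fin n, n * a N * ‖y‖ := Finset.sum_le_sum fun i _ => h1 i
      _ = _ := by simp; ring
  refine ⟨fun N => n * n * a N, ha.mul_left _, fun N k => ?_⟩
  have hadj : LinearMap.adjoint A ^ N = LinearMap.adjoint (A ^ N) := by
    rw [← LinearMap.star_eq_adjoint, ← LinearMap.star_eq_adjoint, star_pow]
  rw [hadj]
  have h := hpow N (LinearMap.adjoint (A ^ N) k)
  have h2 : ‖LinearMap.adjoint (A ^ N) k‖ * ‖LinearMap.adjoint (A ^ N) k‖ ≤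
      ‖k‖ * (n * n * a N * ‖LinearMap.adjoint (A ^ N) k‖) := by
    rw [← real_inner_self_eq_norm_mul_norm, LinearMap.adjoint_inner_left]
    exact (real_inner_le_norm _ _).trans (mul_le_mul_of_nonneg_left h (norm_nonneg _))
  rcases (norm_nonneg (LinearMap.adjoint (A ^ N) k)).eq_or_lt with h0 | h0
  · rw [← h0]
    rcases n.eq_zero_or_pos with hn | hn
    · simp [hn]
    · have := ha0 N ⟨0, hn⟩
      positivity
  · refine le_of_mul_le_mul_right (h2.trans (le_of_eq ?_)) h0
    ring

end Powers

/-! ### Self-similar measures -/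

section SelfSimilar

open scoped NNReal

lemma isCompact_probabilityMeasure_compl_eq_zero {F : Type*} [NormedAddCommGroup F]
    [MeasurableSpace F] [BorelSpace F] {K : Set F} (hK : IsCompact K) :
    IsCompact {μ : ProbabilityMeasure F | (μ : Measure F) Kᶜ = 0} := by
  have h := isCompact_setOfPred_probabilityMeasure_mass_eq_compl_isCompact_le (E := F)
    (u := fun _ => 0) (K := fun _ => K) tendsto_const_nhds (fun _ => hK) (Or.inl inferInstance)
  convert h using 1
  ext μ
  simp only [Set.mem_ofPred_eq, nonpos_iff_eq_zero, forall_const]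
  rw [← ProbabilityMeasure.ennreal_coeFn_eq_coeFn_toMeasure, ENNReal.coe_eq_zero]

variable {E : Type*} [NormedAddCommGroup E] [InnerProductSpace ℝ E] [MeasurableSpace E]
  [BorelSpace E]

lemma tendsto_charFun_of_tendsto {ι : Type*} {l : Filter ι} {μs : ι → ProbabilityMeasure E}
    {μ : ProbabilityMeasure E} (h : Tendsto μs l (𝓝 μ)) (t : E) :
    Tendsto (fun i => charFun (μs i : Measure E) t) l (𝓝 (charFun (μ : Measure E) t)) := by
  rw [ProbabilityMeasure.tendsto_iff_forall_integral_rclike_tendsto ℂ] at h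
  simp_rw [charFun_eq_integral_innerProbChar]
  exact h (BoundedContinuousFunction.innerProbChar t)

lemma norm_charFun_sub_le {ν : Measure E} [IsProbabilityMeasure ν] {R : ℝ}
    (hν : ∀ᵐ x ∂ν, ‖x‖ ≤ R) (s t : E) : ‖charFun ν s - charFun ν t‖ ≤ R * ‖s - t‖ := by
  have hi : ∀ t : E, Integrable (fun x => Complex.exp ((inner ℝ x t : ℝ) * Complex.I)) ν := fun t =>
    (integrable_const (1 : ℝ)).mono (Continuous.aestronglyMeasurable (by fun_prop))
      (Eventually.of_forall fun x => by simp)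
  rw [charFun_apply, charFun_apply, ← integral_sub (hi s) (hi t)]
  have h := norm_integral_le_of_norm_le_const (μ := ν) (C := R * ‖s - t‖)
    (f := fun x => Complex.exp ((inner ℝ x s : ℝ) * Complex.I) -
      Complex.exp ((inner ℝ x t : ℝ) * Complex.I)) (hν.mono fun x hx => ?_)
  · simpa using h
  · have e : Complex.exp ((inner ℝ x s : ℝ) * Complex.I) -
        Complex.exp ((inner ℝ x t : ℝ) * Complex.I) =
        Complex.exp ((inner ℝ x t : ℝ) * Complex.I) *
          (Complex.exp (Complex.I * (inner ℝ x (s - t) : ℝ)) - 1) := by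
      rw [mul_sub, ← Complex.exp_add, mul_one, inner_sub_right]
      congr 2
      push_cast
      ring
    rw [e, norm_mul, Complex.norm_exp_ofReal_mul_I, one_mul]
    refine Real.norm_exp_I_mul_ofReal_sub_one_le.trans ((norm_inner_le_norm _ _).trans ?_)
    gcongr

variable [FiniteDimensional ℝ E]

lemma measurable_linearMap (A : E →ₗ[ℝ] E) : Measurable A :=
  A.continuous_of_finiteDimensional.measurable

lemma charFun_map_linearMap (A : E →ₗ[ℝ] E) (μ : Measure E) (t : E) :
    charFun (μ.map A) t = charFun μ (LinearMap.adjoint A t) := by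
  rw [charFun_apply, charFun_apply, integral_map (measurable_linearMap A).aemeasurable
    (Continuous.aestronglyMeasurable (by fun_prop))]
  simp_rw [LinearMap.adjoint_inner_right]

lemma charFun_conv_map (A : E →ₗ[ℝ] E) (ν μ : Measure E) [IsFiniteMeasure ν] [IsFiniteMeasure μ]
    (t : E) : charFun (ν.conv (μ.map A)) t = charFun ν t * charFun μ (LinearMap.adjoint A t) := by
  have : IsFiniteMeasure (μ.map A) := inferInstance
  rw [charFun_conv, charFun_map_linearMap]

lemma isProbabilityMeasure_conv_map (A : E →ₗ[ℝ] E) (ν μ : Measure E) [IsProbabilityMeasure ν]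
    [IsProbabilityMeasure μ] : IsProbabilityMeasure (ν.conv (μ.map A)) := by
  have : IsProbabilityMeasure (μ.map A) :=
    Measure.isProbabilityMeasure_map (measurable_linearMap A).aemeasurable
  infer_instance

lemma conv_map_apply (A : E →ₗ[ℝ] E) (ν μ : Measure E) [SFinite ν] [SFinite μ] {S : Set E}
    (hS : MeasurableSet S) :
    ν.conv (μ.map A) S = ∫⁻ z, ν ((fun u => u + A z) ⁻¹' S) ∂μ := by
  have hA := measurable_linearMap A
  have hS' : MeasurableSet ((fun x : E × E => x.1 + x.2) ⁻¹' S) := measurable_add hS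
  rw [Measure.conv, Measure.map_apply measurable_add hS, Measure.prod_apply_symm hS',
    lintegral_map (measurable_measure_prodMk_right hS') hA]
  rfl

lemma conv_map_compl_eq_zero {A : E →ₗ[ℝ] E} {ν μ : Measure E} [SFinite ν] [SFinite μ]
    {K W : Set E} (hK : MeasurableSet K) (hν : ν Wᶜ = 0) (hμ : μ Kᶜ = 0)
    (hmap : ∀ u ∈ W, ∀ y ∈ K, A y + u ∈ K) : ν.conv (μ.map A) Kᶜ = 0 := by
  rw [conv_map_apply A ν μ hK.compl]
  have h : ∀ᵐ z ∂μ, z ∈ K := hμ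
  rw [lintegral_congr_ae (g := fun _ => 0) (h.mono fun z hz => ?_)]
  · simp
  · refine measure_mono_null (t := Wᶜ) (fun u hu huW => hu ?_) hν
    simpa [add_comm] using hmap u huW z hz

/-- Iterating the functional equation `charFun μ t = g t * charFun μ (Aᵗ t)` expands `charFun μ`
into an infinite product, because `charFun μ` is continuous with value one at the origin. -/
lemma tendsto_prod_charFun {A : E →ₗ[ℝ] E} {g : E → ℂ} {μ : Measure E} [IsProbabilityMeasure μ]
    (hμ : ∀ t, charFun μ t = g t * charFun μ (LinearMap.adjoint A t))
    (hA : ∀ t, Tendsto (fun N : ℕ => (LinearMap.adjoint A ^ N) t) atTop (𝓝 0)) (t : E) :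
    Tendsto (fun N => ∏ j ∈ Finset.range N, g ((LinearMap.adjoint A ^ j) t)) atTop
      (𝓝 (charFun μ t)) := by
  have hprod : ∀ N, charFun μ t = (∏ j ∈ Finset.range N, g ((LinearMap.adjoint A ^ j) t)) *
      charFun μ ((LinearMap.adjoint A ^ N) t) := fun N => by
    induction N with
    | zero => simp
    | succ N ih =>
      rw [ih, Finset.prod_range_succ, hμ ((LinearMap.adjoint A ^ N) t), pow_succ', mul_assoc]
      rfl
  have hc : Tendsto (fun N => charFun μ ((LinearMap.adjoint A ^ N) t)) atTop (𝓝 1) := by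
    have h0 : charFun μ 0 = 1 := by simp
    rw [← h0]
    exact ((by fun_prop : Continuous (charFun μ)).tendsto 0).comp (hA t)
  have h := (tendsto_const_nhds (x := charFun μ t)).div hc one_ne_zero
  rw [div_one] at h
  refine h.congr' ?_
  filter_upwards [hc.eventually_ne one_ne_zero] with N hN
  rw [Pi.div_apply, div_eq_iff hN]
  exact hprod N

lemma eq_of_charFun_selfSimilar {A : E →ₗ[ℝ] E} {g : E → ℂ} {μ μ' : Measure E}
    [IsProbabilityMeasure μ] [IsProbabilityMeasure μ']
    (hμ : ∀ t, charFun μ t = g t * charFun μ (LinearMap.adjoint A t))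
    (hμ' : ∀ t, charFun μ' t = g t * charFun μ' (LinearMap.adjoint A t))
    (hA : ∀ t, Tendsto (fun N : ℕ => (LinearMap.adjoint A ^ N) t) atTop (𝓝 0)) : μ = μ' :=
  Measure.ext_of_charFun (funext fun t =>
    tendsto_nhds_unique (tendsto_prod_charFun hμ hA t) (tendsto_prod_charFun hμ' hA t))

/-- Existence of self-similar measures: a limit point of the iterates of
`μ ↦ ν ∗ A_* μ` starting from a Dirac measure is a fixed point. -/
lemma exists_eq_conv_map {A : E →ₗ[ℝ] E}
    (hA : ∀ t, Tendsto (fun N : ℕ => (LinearMap.adjoint A ^ N) t) atTop (𝓝 0))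
    {K W : Set E} (hK : IsCompact K) (hK0 : K.Nonempty) (hmap : ∀ u ∈ W, ∀ y ∈ K, A y + u ∈ K)
    (ν : Measure E) [IsProbabilityMeasure ν] (hν : ν Wᶜ = 0) :
    ∃ μ : Measure E, IsProbabilityMeasure μ ∧ μ Kᶜ = 0 ∧ μ = ν.conv (μ.map A) := by
  obtain ⟨y₀, hy₀⟩ := hK0
  set p : ℕ → ProbabilityMeasure E := fun N => N.rec ⟨Measure.dirac y₀, inferInstance⟩
    fun _ μ => ⟨ν.conv ((μ : Measure E).map A), isProbabilityMeasure_conv_map A ν μ⟩ with hp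
  have hp1 : ∀ N, (p (N + 1) : Measure E) = ν.conv ((p N : Measure E).map A) := fun N => rfl
  have hsupp : ∀ N, (p N : Measure E) Kᶜ = 0 := fun N => by
    induction N with
    | zero =>
      change Measure.dirac y₀ Kᶜ = 0
      rw [Measure.dirac_apply' _ hK.measurableSet.compl]
      simp [hy₀]
    | succ N ih =>
      rw [hp1]
      exact conv_map_compl_eq_zero hK.measurableSet hν ih hmap
  obtain ⟨μ, hμK, hμ⟩ := (isCompact_probabilityMeasure_compl_eq_zero hK).ultrafilter_le_nhds'
    ((hyperfilter ℕ : Ultrafilter ℕ).map p) (Ultrafilter.mem_map.2 (Filter.univ_mem' hsupp))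
  have hμ' : Tendsto p (hyperfilter ℕ : Filter ℕ) (𝓝 μ) := hμ
  have hchar : ∀ N t, charFun (p (N + 1) : Measure E) t =
      charFun ν t * charFun (p N : Measure E) (LinearMap.adjoint A t) := fun N t => by
    rw [hp1, charFun_conv_map]
  set d : E → ℂ := fun t => charFun (p 1 : Measure E) t - charFun (p 0 : Measure E) t with hd
  have hdist : ∀ N t, ‖charFun (p (N + 1) : Measure E) t - charFun (p N : Measure E) t‖ ≤
      ‖d ((LinearMap.adjoint A ^ N) t)‖ := fun N => by
    induction N with
    | zero => intro t; simp [hd]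
    | succ N ih =>
      intro t
      rw [hchar (N + 1) t, hchar N t, ← mul_sub, norm_mul, pow_succ]
      refine (mul_le_of_le_one_left (norm_nonneg _) (norm_charFun_le_one t)).trans ?_
      exact ih (LinearMap.adjoint A t)
  have hd0 : ∀ t, Tendsto (fun N => d ((LinearMap.adjoint A ^ N) t)) atTop (𝓝 0) := fun t => by
    have hc : Continuous d := by simp only [hd]; fun_prop
    have h0 : d 0 = 0 := by simp [hd]
    rw [← h0]
    exact (hc.tendsto 0).comp (hA t)
  have hU : (hyperfilter ℕ : Filter ℕ) ≤ atTop := Nat.hyperfilter_le_atTop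
  refine ⟨μ, inferInstance, hμK, ?_⟩
  have := isProbabilityMeasure_conv_map A ν (μ : Measure E)
  refine Measure.ext_of_charFun (funext fun t => ?_)
  rw [charFun_conv_map]
  have h1 : Tendsto (fun N => charFun (p (N + 1) : Measure E) t) (hyperfilter ℕ : Filter ℕ)
      (𝓝 (charFun (μ : Measure E) t)) := by
    have := ((squeeze_zero_norm (hdist · t)
      (tendsto_zero_iff_norm_tendsto_zero.1 (hd0 t))).mono_left hU).add (tendsto_charFun_of_tendsto hμ' t)
    rw [zero_add] at this
    exact this.congr fun N => sub_add_cancel _ _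
  simp_rw [hchar] at h1
  exact tendsto_nhds_unique h1 ((tendsto_charFun_of_tendsto hμ' _).const_mul _)

/-- The infinite product for a self-similar measure converges unconditionally. -/
lemma hasProd_charFun {A : E →ₗ[ℝ] E} {ν μ : Measure E} [IsProbabilityMeasure ν]
    [IsProbabilityMeasure μ] {R : ℝ} (hν : ∀ᵐ x ∂ν, ‖x‖ ≤ R)
    (hμ : ∀ t, charFun μ t = charFun ν t * charFun μ (LinearMap.adjoint A t))
    {a : ℕ → ℝ} (ha : Summable a) (hA : ∀ N t, ‖(LinearMap.adjoint A ^ N) t‖ ≤ a N * ‖t‖) (t : E) :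
    HasProd (fun N : ℕ => charFun ν ((LinearMap.adjoint A ^ N) t)) (charFun μ t) := by
  have hA0 : ∀ t, Tendsto (fun N : ℕ => (LinearMap.adjoint A ^ N) t) atTop (𝓝 0) := fun t =>
    squeeze_zero_norm (hA · t) (by simpa using ha.tendsto_atTop_zero.mul_const ‖t‖)
  have hR : 0 ≤ R := by
    obtain ⟨x, hx⟩ := hν.exists
    exact (norm_nonneg x).trans hx
  have hsum : Summable fun N : ℕ => ‖charFun ν ((LinearMap.adjoint A ^ N) t) - 1‖ := by
    refine Summable.of_nonneg_of_le (fun _ => norm_nonneg _) (fun N => ?_)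
      ((ha.mul_right ‖t‖).mul_left R)
    have := norm_charFun_sub_le hν ((LinearMap.adjoint A ^ N) t) 0
    rw [charFun_zero, probReal_univ, sub_zero, Complex.ofReal_one] at this
    exact this.trans (mul_le_mul_of_nonneg_left (hA N t) hR)
  have hm := multipliable_one_add_of_summable hsum
  simp only [add_sub_cancel] at hm
  rw [← tendsto_nhds_unique hm.hasProd.tendsto_prod_nat (tendsto_prod_charFun hμ hA0 t)]
  exact hm.hasProd

/-- If the weights converge, so do the self-similar measures: by compactness it suffices that
every limit point solves the limiting functional equation, whose solution is unique. -/
lemma tendsto_of_charFun_selfSimilar {ι : Type*} {l : Filter ι} {A : E →ₗ[ℝ] E}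
    (hA : ∀ t, Tendsto (fun N : ℕ => (LinearMap.adjoint A ^ N) t) atTop (𝓝 0))
    {K : Set E} (hK : IsCompact K) {g : ι → E → ℂ} {g' : E → ℂ}
    (hg : ∀ t, Tendsto (fun i => g i t) l (𝓝 (g' t)))
    {μs : ι → ProbabilityMeasure E} {μ : ProbabilityMeasure E}
    (hμs : ∀ᶠ i in l, (μs i : Measure E) Kᶜ = 0 ∧ ∀ t, charFun (μs i : Measure E) t =
      g i t * charFun (μs i : Measure E) (LinearMap.adjoint A t))
    (hμ : ∀ t, charFun (μ : Measure E) t =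
      g' t * charFun (μ : Measure E) (LinearMap.adjoint A t)) :
    Tendsto μs l (𝓝 μ) := by
  refine (isCompact_probabilityMeasure_compl_eq_zero hK).tendsto_nhds_of_unique_mapClusterPt
    (hμs.mono fun i hi => hi.1) fun μ' _ hcl => ?_
  obtain ⟨U, hU, hlim⟩ := mapClusterPt_iff_ultrafilter.1 hcl
  refine Subtype.ext (show (μ' : Measure E) = μ from
    eq_of_charFun_selfSimilar (fun t => ?_) hμ hA)
  refine tendsto_nhds_unique (tendsto_charFun_of_tendsto hlim t) ?_
  refine (((hg t).mono_left hU).mul (tendsto_charFun_of_tendsto hlim _)).congr' ?_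
  filter_upwards [hμs.filter_mono hU] with i hi
  exact (hi.2 t).symm

/-- Pointwise convergence of equi-Lipschitz functions is uniform on compact sets. -/
lemma tendstoUniformlyOn_of_lipschitz {ι X F : Type*} [PseudoMetricSpace X] [PseudoMetricSpace F]
    {l : Filter ι} [l.NeBot] {f : ι → X → F} {f' : X → F} {c : ℝ≥0}
    (hf : ∀ᶠ i in l, LipschitzWith c (f i)) (hlim : ∀ x, Tendsto (fun i => f i x) l (𝓝 (f' x)))
    {K : Set X} (hK : IsCompact K) : TendstoUniformlyOn f f' l K := by
  have hf' : LipschitzWith c f' := LipschitzWith.of_dist_le_mul fun x y =>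
    le_of_tendsto ((hlim x).dist (hlim y)) (hf.mono fun i hi => hi.dist_le_mul x y)
  rw [Metric.tendstoUniformlyOn_iff]
  intro ε hε
  obtain ⟨T, hTK, hT, hcov⟩ := Metric.totallyBounded_iff.1 hK.totallyBounded
    (ε / (3 * (c + 1))) (by positivity) |>.imp fun T hT => (⟨trivial, hT.1, hT.2⟩ : True ∧ _ ∧ _)
  have hε' : c * (ε / (3 * (c + 1))) ≤ ε / 3 := by
    rw [mul_div_assoc', div_le_div_iff₀ (by positivity) (by positivity)]
    nlinarith [c.2]
  filter_upwards [hf, (eventually_all_finite hT).2 fun y (_ : y ∈ T) =>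
    Metric.tendsto_nhds.1 (hlim y) (ε / 3) (by positivity)] with i hi hT' x hx
  obtain ⟨y, hy, hxy⟩ := Set.mem_iUnion₂.1 (hcov hx)
  have hd : c * dist x y ≤ ε / 3 :=
    (mul_le_mul_of_nonneg_left (Metric.mem_ball.1 hxy).le c.2).trans hε'
  calc dist (f' x) (f i x) ≤ dist (f' x) (f' y) + dist (f' y) (f i y) + dist (f i y) (f i x) :=
        dist_triangle4 _ _ _ _
    _ < ε / 3 + ε / 3 + ε / 3 := by
        refine add_lt_add_of_lt_of_le
          (add_lt_add_of_le_of_lt ((hf'.dist_le_mul x y).trans hd) ?_) ?_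
        · rw [dist_comm]; exact hT' y hy
        · rw [dist_comm]; exact (hi.dist_le_mul x y).trans hd
    _ = ε := by ring

end SelfSimilar

/-! ### Weights uniform on a compact set -/

section UniformWeights

variable {n : ℕ}

lemma isCompact_windowQ {A : Euc n →ₗ[ℝ] Euc n} {Ω : Set (Euc n)} (hΩ : IsCompact Ω)
    (hne : Ω.Nonempty) : IsCompact (windowQ A Ω) := by
  obtain ⟨y₀, hy₀⟩ := hne
  have hcl : IsClosed (windowQ A Ω) := by
    have : windowQ A Ω = ⋂ y ∈ Ω, (fun u => A y + u) ⁻¹' Ω := by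
      ext u; simp [windowQ]
    rw [this]
    exact isClosed_biInter fun y _ => hΩ.isClosed.preimage (by fun_prop)
  have hsub : windowQ A Ω ⊆ (fun u => A y₀ + u) ⁻¹' Ω := fun u hu => hu y₀ hy₀
  refine IsCompact.of_isClosed_subset ?_ hcl hsub
  exact (Homeomorph.addLeft (A y₀)).isCompact_preimage.2 hΩ

lemma volume_real_pos_of_interior {W : Set (Euc n)} (hW : IsCompact W)
    (hWi : (interior W).Nonempty) : 0 < volume.real W :=
  ENNReal.toReal_pos ((isOpen_interior.measure_pos volume hWi).trans_le
    (measure_mono interior_subset)).ne' hW.measure_lt_top.ne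

lemma isFiniteMeasure_densityMeasure {f : Euc n → ℝ} (hf : Integrable f) :
    IsFiniteMeasure (densityMeasure f) :=
  isFiniteMeasure_withDensity_ofReal hf.2

lemma densityMeasure_real_apply {f : Euc n → ℝ} (hf : Integrable f) (hf0 : ∀ y, 0 ≤ f y)
    {S : Set (Euc n)} (hS : MeasurableSet S) : (densityMeasure f).real S = ∫ y in S, f y := by
  rw [Measure.real, densityMeasure, withDensity_apply _ hS,
    ← ofReal_integral_eq_lintegral_ofReal hf.integrableOn (Eventually.of_forall hf0),
    ENNReal.toReal_ofReal (integral_nonneg hf0)]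

/-- The law of `u + A z` for `u` uniform on `W` and `z` independent of law `μ` has a density. -/
lemma smul_restrict_conv_map (A : Euc n →ₗ[ℝ] Euc n) {W : Set (Euc n)} (hW : MeasurableSet W)
    (c : ℝ≥0∞) (μ : Measure (Euc n)) [SFinite μ] :
    (c • volume.restrict W).conv (μ.map A) =
      volume.withDensity fun y => c * μ {z | y - A z ∈ W} := by
  have hA := measurable_linearMap A
  have hmeas : MeasurableSet {p : Euc n × Euc n | p.1 - A p.2 ∈ W} :=
    (measurable_fst.sub (hA.comp measurable_snd)) hW
  have hμm : Measurable fun y => μ {z | y - A z ∈ W} := measurable_measure_prodMk_left hmeas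
  rw [Measure.conv_smul_left]
  ext S hS
  rw [Measure.smul_apply, conv_map_apply A _ μ hS, withDensity_apply _ hS,
    lintegral_const_mul _ hμm, smul_eq_mul]
  congr 1
  have h1 : ∀ z, (volume.restrict W) ((fun u => u + A z) ⁻¹' S) =
      ∫⁻ y in S, W.indicator 1 (y - A z) := fun z => by
    rw [Measure.restrict_apply ((measurable_add_const _) hS), ← lintegral_indicator hS,
      ← lintegral_add_right_eq_self _ (A z),
      ← lintegral_indicator_one ((measurable_add_const (A z) hS).inter hW)]
    refine lintegral_congr fun u => ?_
    by_cases h : u + A z ∈ S <;> by_cases h' : u ∈ W <;> simp [h, h']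
  simp_rw [h1]
  rw [lintegral_lintegral_swap]
  · refine lintegral_congr fun y => ?_
    exact (lintegral_congr fun z => rfl).trans
      (lintegral_indicator_one (measurable_prodMk_left hmeas : MeasurableSet {z | y - A z ∈ W}))
  · refine Measurable.aemeasurable ?_
    exact (measurable_one.indicator hW).comp (measurable_snd.sub (hA.comp measurable_fst))

/-- The measure of `{z | y - A z ∈ W}` depends continuously on `y`, since the boundary of `W` is
negligible. -/
lemma continuous_measure_sub_mem {A : Euc n →ₗ[ℝ] Euc n} (hA : LinearMap.det A ≠ 0)
    {W : Set (Euc n)} (hW : MeasurableSet W) (hW0 : volume (frontier W) = 0)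
    {μ : Measure (Euc n)} [IsFiniteMeasure μ] (hμ : μ ≪ volume) :
    Continuous fun y => μ.real {z | y - A z ∈ W} := by
  have hAm := measurable_linearMap A
  rw [continuous_iff_continuousAt]
  intro y
  refine (ENNReal.tendsto_toReal (measure_ne_top _ _)).comp ?_
  refine tendsto_measure_of_ae_tendsto_indicator_of_isFiniteMeasure (L := 𝓝 y)
    (As := fun y => {z | y - A z ∈ W}) ((hAm.const_sub y) hW) (fun y => (hAm.const_sub y) hW) ?_
  have hnull : volume (A ⁻¹' ((fun w => y - w) ⁻¹' frontier W)) = 0 := by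
    rw [Measure.addHaar_preimage_linearMap _ hA,
      (Measure.measurePreserving_sub_left volume y).measure_preimage
        isClosed_frontier.measurableSet.nullMeasurableSet, hW0, mul_zero]
  have hae : ∀ᵐ z ∂μ, y - A z ∉ frontier W := measure_eq_zero_iff_ae_notMem.1 (hμ hnull)
  filter_upwards [hae] with z hz
  have hcont : Tendsto (fun y' => y' - A z) (𝓝 y) (𝓝 (y - A z)) := by
    have : Continuous fun y' => y' - A z := by fun_prop
    exact this.tendsto y
  by_cases hzW : y - A z ∈ W
  · have hi : y - A z ∈ interior W := by
      by_contra h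
      exact hz ⟨subset_closure hzW, h⟩
    filter_upwards [hcont.eventually (isOpen_interior.mem_nhds hi)] with y' hy'
    exact ⟨fun _ => hzW, fun _ => interior_subset hy'⟩
  · have hi : y - A z ∈ (closure W)ᶜ := fun h => hz ⟨h, fun h' => hzW (interior_subset h')⟩
    filter_upwards [hcont.eventually (isClosed_closure.isOpen_compl.mem_nhds hi)] with y' hy'
    exact ⟨fun h => absurd (subset_closure h) hy', fun h => absurd h hzW⟩

/-- Change of variables `u = y - A z` in the averaging condition. -/
lemma densityMeasure_real_sub_mem {A : Euc n →ₗ[ℝ] Euc n} (hA : LinearMap.det A ≠ 0)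
    {W : Set (Euc n)} (hW : MeasurableSet W) {f : Euc n → ℝ} (hf : Integrable f)
    (hf0 : ∀ y, 0 ≤ f y) (y : Euc n) :
    (densityMeasure f).real {z | y - A z ∈ W} =
      |LinearMap.det A|⁻¹ * ∫ u in W, f ((A.equivOfDetNeZero hA).symm (y - u)) := by
  have hAm := measurable_linearMap A
  set e := A.equivOfDetNeZero hA with he
  have hee : ∀ z, e.symm (A z) = z := fun z => e.symm_apply_apply z
  have hS : MeasurableSet {z | y - A z ∈ W} := (hAm.const_sub y) hW
  have hemb : MeasurableEmbedding A :=
    e.toContinuousLinearEquiv.toHomeomorph.measurableEmbedding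
  rw [densityMeasure_real_apply hf hf0 hS, ← integral_indicator hS, ← integral_indicator hW]
  have h := hemb.integral_map (μ := volume)
    (fun w => W.indicator (fun u => f (e.symm (y - u))) (y - w))
  rw [Measure.map_linearMap_addHaar_eq_smul_addHaar _ hA, integral_smul_measure,
    ENNReal.toReal_ofReal (abs_nonneg _), abs_inv, smul_eq_mul,
    integral_sub_left_eq_self (W.indicator fun u => f (e.symm (y - u))) volume y] at h
  rw [h]
  refine integral_congr_ae (Eventually.of_forall fun z => ?_)
  by_cases hz : y - A z ∈ W <;> simp [hz, hee]

end UniformWeights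

/-! ### Invariant densities as self-similar densities -/

section InvariantDensity

variable {m n : ℕ} {C : CutAndProject m n} {Ω : Set (Euc n)} {Q : Euc m ≃ₗ[ℝ] Euc m}
  {A : Euc n →ₗ[ℝ] Euc n}

lemma CutAndProject.density_eq_mul {f : Euc n → ℝ} (hf : ∀ y ∉ Ω, f y = 0) {x : Euc m}
    (hx : x ∈ C.L) : C.density Ω f x = volume.real Ω * f (C.star x) := by
  unfold CutAndProject.density
  split_ifs with h
  · rfl
  · rw [hf _ fun h' => h ⟨hx, h'⟩, mul_zero]

lemma integrable_of_eq_zero_off {f : Euc n → ℝ} (hΩ : IsCompact Ω) (hf : Continuous f)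
    (hf0 : ∀ y ∉ Ω, f y = 0) : Integrable f :=
  hf.integrable_of_hasCompactSupport (HasCompactSupport.intro hΩ fun y hy => hf0 y hy)

namespace IsCompatibleSimilarity

/-- The averages in the definition of an invariant density converge to an integral over the window
of the translations. -/
lemma tendsto_average (hQ : IsCompatibleSimilarity C Ω Q A) (hΩ : IsWindow Ω) {f : Euc n → ℝ}
    (hf : Continuous f) (hf0 : ∀ y ∉ Ω, f y = 0) {x : Euc m} (hx : x ∈ C.L) :
    Tendsto (fun s : ℝ => |LinearMap.det (Q : Euc m →ₗ[ℝ] Euc m)| /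
        ((truncate (C.transl Ω A) s).ncard : ℝ) *
      ∑ᶠ v ∈ truncate (C.transl Ω A) s, C.density Ω f (Q.symm (x - v))) atTop
      (𝓝 (volume.real Ω * ((volume.real (windowQ A Ω))⁻¹ * (|LinearMap.det A|⁻¹ *
        ∫ u in windowQ A Ω, f ((A.equivOfDetNeZero hQ.det_ne_zero).symm (C.star x - u)))))) := by
  set e := A.equivOfDetNeZero hQ.det_ne_zero with he
  have hW := isCompact_windowQ (A := A) hΩ.isCompact hΩ.nonempty
  have hcont : Continuous fun u => f (e.symm (C.star x - u)) := by
    have : Continuous e.symm := (e.symm : Euc n →ₗ[ℝ] Euc n).continuous_of_finiteDimensional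
    fun_prop
  have h := (C.tendsto_average_truncate_modelSet hW hQ.frontier_null hQ.interior_nonempty
    hcont).const_mul (|LinearMap.det (Q : Euc m →ₗ[ℝ] Euc m)| * volume.real Ω)
  have hdet : |LinearMap.det A|⁻¹ = |LinearMap.det (Q : Euc m →ₗ[ℝ] Euc m)| :=
    (eq_inv_of_mul_eq_one_left hQ.abs_det_mul_abs_det).symm
  rw [hdet]
  have hlim : ∀ (a b c d : ℝ), a * (b * (c * d)) = c * a * (b * d) := fun a b c d => by ring
  rw [hlim]
  refine h.congr fun s => ?_
  have hsum : ∑ᶠ v ∈ truncate (C.transl Ω A) s, C.density Ω f (Q.symm (x - v)) =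
      ∑ᶠ v ∈ truncate (C.modelSet (windowQ A Ω)) s,
        volume.real Ω * f (e.symm (C.star x - C.star v)) := by
    refine finsum_mem_congr rfl fun v hv => ?_
    have hv1 : v ∈ C.L := hv.1.1
    have hL := hQ.symm_mem_L (C.sub_mem_L hx hv1)
    rw [CutAndProject.density_eq_mul hf0 hL]
    have h1 := hQ.star_map _ hL
    rw [LinearEquiv.apply_symm_apply, C.star_sub hx hv1] at h1
    rw [h1]
    congr 2
    exact (e.symm_apply_apply _).symm
  rw [hsum, ← mul_finsum_mem, CutAndProject.transl]
  ring

lemma tendsto_mean_density (hΩ : IsWindow Ω) {f : Euc n → ℝ}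
    (hf : Continuous f) (hf0 : ∀ y ∉ Ω, f y = 0) :
    Tendsto (fun s : ℝ => ((truncate (C.modelSet Ω) s).ncard : ℝ)⁻¹ *
      ∑ᶠ x ∈ truncate (C.modelSet Ω) s, C.density Ω f x) atTop (𝓝 (∫ y, f y)) := by
  have hi : (interior Ω).Nonempty := by
    rw [← closure_nonempty_iff, ← hΩ.closure_interior]
    exact hΩ.nonempty
  have hpos := volume_real_pos_of_interior hΩ.isCompact hi
  have h := C.tendsto_average_truncate_modelSet hΩ.isCompact hΩ.frontier_null hi
    (h := fun y => volume.real Ω * f y) (by fun_prop)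
  rw [integral_const_mul, inv_mul_cancel_left₀ hpos.ne',
    setIntegral_eq_integral_of_forall_compl_eq_zero fun y hy => hf0 y hy] at h
  refine h.congr fun s => ?_
  congr 1
  exact finsum_mem_congr rfl fun x hx => (CutAndProject.density_eq_mul hf0 hx.1.1).symm

/-- Invariant densities are the continuous probability densities `f` on `Ω` for which the law
`f dy` is self-similar, pointwise on densities. -/
lemma isInvariantWindowDensity_iff (hQ : IsCompatibleSimilarity C Ω Q A) (hΩ : IsWindow Ω)
    {f : Euc n → ℝ} : C.IsInvariantWindowDensity Ω Q A f ↔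
      Continuous f ∧ (∀ y ∉ Ω, f y = 0) ∧ (∀ y, 0 ≤ f y) ∧ ∫ y, f y = 1 ∧
      ∀ y, f y = (volume.real (windowQ A Ω))⁻¹ *
        (densityMeasure f).real {z | y - A z ∈ windowQ A Ω} := by
  have hW := isCompact_windowQ (A := A) hΩ.isCompact hΩ.nonempty
  have hi : (interior Ω).Nonempty := by
    rw [← closure_nonempty_iff, ← hΩ.closure_interior]
    exact hΩ.nonempty
  have hpos := volume_real_pos_of_interior hΩ.isCompact hi
  constructor
  · rintro ⟨hf, hsupp, hinv⟩
    have hf0 : ∀ y ∉ Ω, f y = 0 := fun y hy =>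
      image_eq_zero_of_notMem_tsupport fun h => hy (hsupp h)
    have hnn : ∀ y, 0 ≤ f y := by
      have hcl : IsClosed {y | 0 ≤ f y} := isClosed_le continuous_const hf
      have hsub : C.star '' C.L ⊆ {y | 0 ≤ f y} := by
        rintro _ ⟨x, hx, rfl⟩
        by_cases hxΩ : C.star x ∈ Ω
        · have := hinv.nonneg x ⟨hx, hxΩ⟩
          rw [CutAndProject.density_eq_mul hf0 hx] at this
          exact nonneg_of_mul_nonneg_right this hpos
        · exact (hf0 _ hxΩ).ge
      intro y
      exact hcl.closure_subset_iff.2 hsub (C.dense_star_image y)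
    have hint := integrable_of_eq_zero_off hΩ.isCompact hf hf0
    have := isFiniteMeasure_densityMeasure hint
    refine ⟨hf, hf0, hnn, tendsto_nhds_unique (tendsto_mean_density hΩ hf hf0) hinv.normalized, ?_⟩
    have hcont : Continuous fun y => (volume.real (windowQ A Ω))⁻¹ *
        (densityMeasure f).real {z | y - A z ∈ windowQ A Ω} :=
      (continuous_measure_sub_mem (μ := densityMeasure f) hQ.det_ne_zero hW.measurableSet
        hQ.frontier_null (withDensity_absolutelyContinuous _ _)).const_mul _
    refine congrFun (hf.ext_on C.dense_star_image hcont ?_)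
    rintro _ ⟨x, hx, rfl⟩
    have h := tendsto_nhds_unique (hinv.average x hx) (hQ.tendsto_average hΩ hf hf0 hx)
    rw [CutAndProject.density_eq_mul hf0 hx] at h
    beta_reduce
    rw [mul_left_cancel₀ hpos.ne' h,
      densityMeasure_real_sub_mem hQ.det_ne_zero hW.measurableSet hint hnn]
  · rintro ⟨hf, hf0, hnn, h1, hself⟩
    have hint := integrable_of_eq_zero_off hΩ.isCompact hf hf0
    refine ⟨hf, closure_minimal (fun y hy => ?_) hΩ.isCompact.isClosed, ?_, fun x hx => ?_, ?_⟩
    · by_contra h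
      exact hy (hf0 y h)
    · intro x hx
      rw [CutAndProject.density_eq_mul hf0 hx.1]
      exact mul_nonneg hpos.le (hnn _)
    · have h := hQ.tendsto_average hΩ hf hf0 hx
      rwa [← densityMeasure_real_sub_mem hQ.det_ne_zero hW.measurableSet hint hnn, ← hself,
        ← CutAndProject.density_eq_mul hf0 hx] at h
    · rw [← h1]
      exact tendsto_mean_density hΩ hf hf0

lemma tendsto_adjoint_pow (hQ : IsCompatibleSimilarity C Ω Q A) (t : Euc n) :
    Tendsto (fun N : ℕ => (LinearMap.adjoint A ^ N) t) atTop (𝓝 0) := by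
  obtain ⟨a, ha, hle⟩ := exists_summable_adjoint_pow A hQ.eigenvalue_lt_one
  exact squeeze_zero_norm (hle · t) (by simpa using ha.tendsto_atTop_zero.mul_const ‖t‖)

lemma isProbabilityMeasure_cond_windowQ (hQ : IsCompatibleSimilarity C Ω Q A) (hΩ : IsWindow Ω) :
    IsProbabilityMeasure (ProbabilityTheory.cond volume (windowQ A Ω)) := by
  have hW := isCompact_windowQ (A := A) hΩ.isCompact hΩ.nonempty
  refine ProbabilityTheory.cond_isProbabilityMeasure_of_finite ?_ hW.measure_lt_top.ne
  exact ((isOpen_interior.measure_pos volume hQ.interior_nonempty).trans_le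
    (measure_mono interior_subset)).ne'

lemma cond_windowQ_conv_map (hQ : IsCompatibleSimilarity C Ω Q A) (hΩ : IsWindow Ω)
    (μ : Measure (Euc n)) [IsFiniteMeasure μ] :
    (ProbabilityTheory.cond volume (windowQ A Ω)).conv (μ.map A) =
      densityMeasure fun y => (volume.real (windowQ A Ω))⁻¹ *
        μ.real {z | y - A z ∈ windowQ A Ω} := by
  have hW := isCompact_windowQ (A := A) hΩ.isCompact hΩ.nonempty
  have hpos := volume_real_pos_of_interior hW hQ.interior_nonempty
  rw [ProbabilityTheory.cond, smul_restrict_conv_map A hW.measurableSet, densityMeasure]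
  congr 1
  funext y
  rw [ENNReal.ofReal_mul (by positivity), ENNReal.ofReal_inv_of_pos hpos,
    ofReal_measureReal hW.measure_lt_top.ne, ofReal_measureReal (measure_ne_top _ _)]

lemma densityMeasure_eq_conv_map (hQ : IsCompatibleSimilarity C Ω Q A) (hΩ : IsWindow Ω)
    {f : Euc n → ℝ} (hf : C.IsInvariantWindowDensity Ω Q A f) :
    IsProbabilityMeasure (densityMeasure f) ∧ densityMeasure f =
      (ProbabilityTheory.cond volume (windowQ A Ω)).conv ((densityMeasure f).map A) := by
  obtain ⟨hc, hf0, hnn, h1, hself⟩ := (hQ.isInvariantWindowDensity_iff hΩ).1 hf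
  have hint := integrable_of_eq_zero_off hΩ.isCompact hc hf0
  have := isFiniteMeasure_densityMeasure hint
  refine ⟨⟨?_⟩, ?_⟩
  · have h := densityMeasure_real_apply hint hnn MeasurableSet.univ
    rw [setIntegral_univ, h1] at h
    rw [← ofReal_measureReal (measure_ne_top _ _), h, ENNReal.ofReal_one]
  · rw [hQ.cond_windowQ_conv_map hΩ]
    exact congrArg densityMeasure (funext hself)

/-- The density of the self-similar measure with weights uniform on the window of translations is an
invariant density. -/
lemma exists_isInvariantWindowDensity (hQ : IsCompatibleSimilarity C Ω Q A) (hΩ : IsWindow Ω) :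
    ∃ f, C.IsInvariantWindowDensity Ω Q A f := by
  have hW := isCompact_windowQ (A := A) hΩ.isCompact hΩ.nonempty
  have := hQ.isProbabilityMeasure_cond_windowQ hΩ
  have hνW : ProbabilityTheory.cond volume (windowQ A Ω) (windowQ A Ω)ᶜ = 0 := by
    rw [ProbabilityTheory.cond_apply hW.measurableSet]
    simp
  obtain ⟨μ, hμ, hμΩ, hself⟩ := exists_eq_conv_map hQ.tendsto_adjoint_pow hΩ.isCompact hΩ.nonempty
    (W := windowQ A Ω) (fun u hu y hy => hu y hy) _ hνW
  rw [hQ.cond_windowQ_conv_map hΩ] at hself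
  set f : Euc n → ℝ := fun y => (volume.real (windowQ A Ω))⁻¹ *
    μ.real {z | y - A z ∈ windowQ A Ω} with hf
  have hac : μ ≪ volume := hself ▸ withDensity_absolutelyContinuous _ _
  have hc : Continuous f := (continuous_measure_sub_mem hQ.det_ne_zero hW.measurableSet
    hQ.frontier_null hac).const_mul _
  have hf0 : ∀ y ∉ Ω, f y = 0 := fun y hy => by
    have : μ {z | y - A z ∈ windowQ A Ω} = 0 := by
      refine measure_mono_null (t := Ωᶜ) (fun z hz hzΩ => hy ?_) hμΩ
      have := hz z hzΩ
      rwa [add_sub_cancel] at this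
    simp [hf, Measure.real, this]
  have hnn : ∀ y, 0 ≤ f y := fun y => by positivity
  have hint := integrable_of_eq_zero_off hΩ.isCompact hc hf0
  refine ⟨f, (hQ.isInvariantWindowDensity_iff hΩ).2 ⟨hc, hf0, hnn, ?_, fun y => ?_⟩⟩
  · rw [← setIntegral_univ, ← densityMeasure_real_apply hint hnn MeasurableSet.univ, ← hself]
    simp
  · rw [← hself]

/-- An invariant density is determined by its Fourier transform, which is an infinite product. -/
lemma isInvariantWindowDensity_unique (hQ : IsCompatibleSimilarity C Ω Q A) (hΩ : IsWindow Ω)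
    {f g : Euc n → ℝ} (hf : C.IsInvariantWindowDensity Ω Q A f)
    (hg : C.IsInvariantWindowDensity Ω Q A g) : f = g := by
  have := hQ.isProbabilityMeasure_cond_windowQ hΩ
  obtain ⟨_, hf2⟩ := hQ.densityMeasure_eq_conv_map hΩ hf
  obtain ⟨_, hg2⟩ := hQ.densityMeasure_eq_conv_map hΩ hg
  have heq : densityMeasure f = densityMeasure g := eq_of_charFun_selfSimilar
    (fun t => by conv_lhs => rw [hf2, charFun_conv_map])
    (fun t => by conv_lhs => rw [hg2, charFun_conv_map]) hQ.tendsto_adjoint_pow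
  obtain ⟨-, -, -, -, hf5⟩ := (hQ.isInvariantWindowDensity_iff hΩ).1 hf
  obtain ⟨-, -, -, -, hg5⟩ := (hQ.isInvariantWindowDensity_iff hΩ).1 hg
  funext y
  rw [hf5, hg5, heq]

end IsCompatibleSimilarity

end InvariantDensity

/-! ### Hutchinson measures and their convergence -/

section Hutchinson

variable {m n : ℕ}

lemma fourierMeasure_eq_charFun (μ : Measure (Euc n)) (k : Euc n) :
    fourierMeasure μ k = charFun μ (-(2 * Real.pi) • k) := by
  rw [fourierMeasure, charFun_apply]
  refine integral_congr_ae (Eventually.of_forall fun x => ?_)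
  beta_reduce
  rw [real_inner_smul_right, real_inner_comm]
  congr 1
  push_cast
  ring

namespace CutAndProject

variable (C : CutAndProject m n)

/-- The uniform probability measure on the finite family of star images of the points of the model
set in the ball of radius `s`. -/
noncomputable def starMeasure (W : Set (Euc n)) (s : ℝ) : Measure (Euc n) :=
  ((truncate (C.modelSet W) s).ncard : ℝ≥0∞)⁻¹ •
    ∑ᶠ v ∈ truncate (C.modelSet W) s, Measure.dirac (C.star v)

variable {W : Set (Euc n)}

lemma starMeasure_eq_sum (hW : Bornology.IsBounded W) (s : ℝ) : C.starMeasure W s =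
    ((truncate (C.modelSet W) s).ncard : ℝ≥0∞)⁻¹ •
      ∑ v ∈ (C.finite_truncate_modelSet hW s).toFinset, Measure.dirac (C.star v) := by
  rw [starMeasure, finsum_mem_eq_finite_toFinset_sum _ (C.finite_truncate_modelSet hW s)]

lemma isProbabilityMeasure_starMeasure (hW : Bornology.IsBounded W) {s : ℝ}
    (hs : (truncate (C.modelSet W) s).Nonempty) : IsProbabilityMeasure (C.starMeasure W s) := by
  refine ⟨?_⟩
  have hfin := C.finite_truncate_modelSet hW s
  rw [C.starMeasure_eq_sum hW, Measure.smul_apply, Measure.finsetSum_apply, smul_eq_mul]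
  simp only [measure_univ, Finset.sum_const, nsmul_eq_mul, mul_one]
  rw [Set.ncard_eq_toFinset_card _ hfin]
  refine ENNReal.inv_mul_cancel ?_ (ENNReal.natCast_ne_top _)
  rw [Nat.cast_ne_zero]
  exact (Finset.card_pos.2 (hfin.toFinset_nonempty.2 hs)).ne'

lemma starMeasure_compl (hW : Bornology.IsBounded W) (hWm : MeasurableSet W) (s : ℝ) :
    C.starMeasure W s Wᶜ = 0 := by
  rw [C.starMeasure_eq_sum hW, Measure.smul_apply, Measure.finsetSum_apply, Finset.sum_eq_zero]
  · simp
  · intro v hv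
    have hv' : C.star v ∈ W := ((C.finite_truncate_modelSet hW s).mem_toFinset.1 hv).1.2
    rw [Measure.dirac_apply' _ hWm.compl]
    simp [hv']

lemma integral_starMeasure {G : Type*} [NormedAddCommGroup G] [NormedSpace ℝ G] [CompleteSpace G]
    (hW : Bornology.IsBounded W) (h : Euc n → G) (s : ℝ) :
    ∫ y, h y ∂(C.starMeasure W s) = ((truncate (C.modelSet W) s).ncard : ℝ)⁻¹ •
      ∑ᶠ v ∈ truncate (C.modelSet W) s, h (C.star v) := by
  rw [C.starMeasure_eq_sum hW, integral_smul_measure, integral_finsetSum_measure,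
    finsum_mem_eq_finite_toFinset_sum _ (C.finite_truncate_modelSet hW s)]
  · simp
  · intro v _
    exact integrable_dirac enorm_lt_top

lemma expAverage_eq_charFun {A : Euc n →ₗ[ℝ] Euc n} {Ω : Set (Euc n)}
    (hW : Bornology.IsBounded (windowQ A Ω)) (s : ℝ) (k : Euc n) :
    C.expAverage Ω A s k = charFun (C.starMeasure (windowQ A Ω) s) (-(2 * Real.pi) • k) := by
  rw [← fourierMeasure_eq_charFun, fourierMeasure, C.integral_starMeasure hW, expAverage, transl,
    Complex.real_smul]
  push_cast
  rfl

/-- `starMeasure` converges weakly to the uniform measure on the window. -/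
lemma tendsto_charFun_starMeasure (hW : IsCompact W) (hW0 : volume (frontier W) = 0)
    (hWi : (interior W).Nonempty) (t : Euc n) :
    Tendsto (fun s => charFun (C.starMeasure W s) t) atTop
      (𝓝 (charFun (ProbabilityTheory.cond volume W) t)) := by
  have hreal : ∀ h : Euc n → ℝ, Continuous h → Tendsto (fun s => ∫ y, h y ∂(C.starMeasure W s))
      atTop (𝓝 (∫ y, h y ∂(ProbabilityTheory.cond volume W))) := fun h hh => by
    have := C.tendsto_average_truncate_modelSet hW hW0 hWi hh
    rw [ProbabilityTheory.cond, integral_smul_measure, smul_eq_mul, ENNReal.toReal_inv]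
    refine this.congr fun s => ?_
    rw [C.integral_starMeasure hW.isBounded, smul_eq_mul]
  set F : Euc n → ℂ := fun y => Complex.exp ((inner ℝ y t : ℝ) * Complex.I) with hF
  have hFc : Continuous F := by fun_prop
  have hint : ∀ μ : Measure (Euc n), IsFiniteMeasure μ → Integrable F μ := fun μ _ =>
    (integrable_const (1 : ℝ)).mono hFc.aestronglyMeasurable
      (Eventually.of_forall fun x => by simp [hF])
  have hsplit : ∀ μ : Measure (Euc n), IsFiniteMeasure μ → charFun μ t =
      ((∫ y, (F y).re ∂μ : ℝ) : ℂ) + ((∫ y, (F y).im ∂μ : ℝ) : ℂ) * Complex.I := fun μ hμ =>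
    (integral_re_add_im (𝕜 := ℂ) (hint μ hμ)).symm
  rw [hsplit _ inferInstance]
  have h1 := (Complex.continuous_ofReal.tendsto _).comp
    (hreal (fun y => (F y).re) (Complex.continuous_re.comp hFc))
  have h2 := (Complex.continuous_ofReal.tendsto _).comp
    (hreal (fun y => (F y).im) (Complex.continuous_im.comp hFc))
  refine (h1.add (h2.mul_const Complex.I)).congr' ?_
  filter_upwards [C.eventually_truncate_modelSet_nonempty hWi] with s hs
  have := C.isProbabilityMeasure_starMeasure hW.isBounded hs
  exact (hsplit _ inferInstance).symm

lemma starMeasure_conv_map {A : Euc n →ₗ[ℝ] Euc n} {Ω : Set (Euc n)}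
    (hW : Bornology.IsBounded (windowQ A Ω)) (s : ℝ) (μ : Measure (Euc n)) [IsFiniteMeasure μ] :
    (C.starMeasure (windowQ A Ω) s).conv (μ.map A) =
      ((truncate (C.transl Ω A) s).ncard : ℝ≥0∞)⁻¹ •
        ∑ᶠ v ∈ truncate (C.transl Ω A) s, μ.map (C.tStar A v) := by
  have hfin := C.finite_truncate_modelSet hW s
  rw [C.starMeasure_eq_sum hW, Measure.conv_smul_left, transl,
    finsum_mem_eq_finite_toFinset_sum _ hfin]
  congr 1
  have hmap : ∀ v, (Measure.dirac (C.star v)).conv (μ.map A) = μ.map (C.tStar A v) := fun v => by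
    rw [Measure.dirac_conv, Measure.map_map (by fun_prop) (measurable_linearMap A)]
    congr 1
    funext y
    exact add_comm _ _
  classical
  induction hfin.toFinset using Finset.induction_on with
  | empty => simp
  | insert v T hv ih =>
    rw [Finset.sum_insert hv, Finset.sum_insert hv, Measure.add_conv, ih, hmap]

end CutAndProject

variable {C : CutAndProject m n} {Ω : Set (Euc n)} {Q : Euc m ≃ₗ[ℝ] Euc m}
  {A : Euc n →ₗ[ℝ] Euc n}

namespace IsCompatibleSimilarity

lemma isHutchinsonMeasure_iff (hΩ : IsWindow Ω) {s : ℝ} {μ : Measure (Euc n)} :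
    C.IsHutchinsonMeasure Ω A s μ ↔ IsProbabilityMeasure μ ∧ μ Ωᶜ = 0 ∧
      μ = (C.starMeasure (windowQ A Ω) s).conv (μ.map A) := by
  have hW := (isCompact_windowQ (A := A) hΩ.isCompact hΩ.nonempty).isBounded
  constructor
  · rintro ⟨h1, h2, h3⟩
    exact ⟨h1, h2, by rw [C.starMeasure_conv_map hW]; exact h3⟩
  · rintro ⟨h1, h2, h3⟩
    exact ⟨h1, h2, by rwa [C.starMeasure_conv_map hW] at h3⟩

lemma charFun_hutchinson (hΩ : IsWindow Ω) {s : ℝ} (hs : (truncate (C.transl Ω A) s).Nonempty)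
    {μ : Measure (Euc n)} (hμ : C.IsHutchinsonMeasure Ω A s μ) (t : Euc n) :
    charFun μ t = charFun (C.starMeasure (windowQ A Ω) s) t *
      charFun μ (LinearMap.adjoint A t) := by
  have hW := (isCompact_windowQ (A := A) hΩ.isCompact hΩ.nonempty).isBounded
  obtain ⟨h1, -, h3⟩ := (isHutchinsonMeasure_iff hΩ).1 hμ
  have := C.isProbabilityMeasure_starMeasure hW hs
  conv_lhs => rw [h3, charFun_conv_map]

lemma existsUnique_isHutchinsonMeasure (hQ : IsCompatibleSimilarity C Ω Q A) (hΩ : IsWindow Ω)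
    {s : ℝ} (hs : (truncate (C.transl Ω A) s).Nonempty) :
    ∃! μ : Measure (Euc n), C.IsHutchinsonMeasure Ω A s μ := by
  have hW := isCompact_windowQ (A := A) hΩ.isCompact hΩ.nonempty
  have := C.isProbabilityMeasure_starMeasure hW.isBounded hs
  obtain ⟨μ, hμ, hμΩ, hself⟩ := exists_eq_conv_map hQ.tendsto_adjoint_pow hΩ.isCompact hΩ.nonempty
    (W := windowQ A Ω) (fun u hu y hy => hu y hy) _
    (C.starMeasure_compl hW.isBounded hW.measurableSet s)
  have hH : C.IsHutchinsonMeasure Ω A s μ := (isHutchinsonMeasure_iff hΩ).2 ⟨hμ, hμΩ, hself⟩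
  refine ⟨μ, hH, fun μ' hμ' => ?_⟩
  have := hμ'.isProbabilityMeasure
  exact eq_of_charFun_selfSimilar (charFun_hutchinson hΩ hs hμ') (charFun_hutchinson hΩ hs hH)
    hQ.tendsto_adjoint_pow

lemma adjoint_pow_smul (N : ℕ) (c : ℝ) (k : Euc n) :
    c • (LinearMap.adjoint A ^ N) k = (LinearMap.adjoint A ^ N) (c • k) :=
  (map_smul _ _ _).symm

lemma hasProd_fourierMeasure (hQ : IsCompatibleSimilarity C Ω Q A) (hΩ : IsWindow Ω)
    {s : ℝ} (hs : (truncate (C.transl Ω A) s).Nonempty) {μ : Measure (Euc n)}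
    (hμ : C.IsHutchinsonMeasure Ω A s μ) (k : Euc n) :
    HasProd (fun N : ℕ => C.expAverage Ω A s ((LinearMap.adjoint A ^ N) k))
      (fourierMeasure μ k) := by
  have hW := isCompact_windowQ (A := A) hΩ.isCompact hΩ.nonempty
  obtain ⟨a, ha, hle⟩ := exists_summable_adjoint_pow A hQ.eigenvalue_lt_one
  obtain ⟨R, hR⟩ := hW.isBounded.exists_norm_le
  have := C.isProbabilityMeasure_starMeasure hW.isBounded hs
  have := hμ.isProbabilityMeasure
  have hae : ∀ᵐ x ∂(C.starMeasure (windowQ A Ω) s), x ∈ windowQ A Ω :=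
    C.starMeasure_compl hW.isBounded hW.measurableSet s
  simp_rw [C.expAverage_eq_charFun hW.isBounded, fourierMeasure_eq_charFun, adjoint_pow_smul]
  exact hasProd_charFun (hae.mono fun x hx => hR x hx) (charFun_hutchinson hΩ hs hμ) ha hle _

end IsCompatibleSimilarity

/-- Weakly convergent probability measures carried by a common compact set converge also against
unbounded continuous functions. -/
lemma tendsto_integral_of_compl_eq_zero {ι : Type*} {l : Filter ι} {K : Set (Euc n)}
    (hK : IsCompact K) {p : ι → ProbabilityMeasure (Euc n)} {q : ProbabilityMeasure (Euc n)}
    (hp : Tendsto p l (𝓝 q)) (hpK : ∀ᶠ i in l, (p i : Measure (Euc n)) Kᶜ = 0)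
    (hqK : (q : Measure (Euc n)) Kᶜ = 0) {φ : Euc n → ℂ} (hφ : Continuous φ) :
    Tendsto (fun i => ∫ x, φ x ∂(p i : Measure (Euc n))) l
      (𝓝 (∫ x, φ x ∂(q : Measure (Euc n)))) := by
  obtain ⟨χ, hχ1, -, hχc, -⟩ := exists_continuous_one_zero_of_isCompact hK isClosed_empty
    (Set.disjoint_empty _)
  have hψ : Continuous fun x => (χ x : ℂ) * φ x :=
    (Complex.continuous_ofReal.comp χ.continuous).mul hφ
  have hψc : HasCompactSupport fun x => (χ x : ℂ) * φ x :=
    (hχc.comp_left (g := ((↑) : ℝ → ℂ)) Complex.ofReal_zero).mul_right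
  obtain ⟨c, hc⟩ := hψc.exists_bound_of_continuous hψ
  have hcongr : ∀ ρ : Measure (Euc n), ρ Kᶜ = 0 → ∫ x, (χ x : ℂ) * φ x ∂ρ = ∫ x, φ x ∂ρ :=
    fun ρ hρ => by
      have hae : ∀ᵐ x ∂ρ, x ∈ K := hρ
      refine integral_congr_ae (hae.mono fun x hx => ?_)
      have : χ x = 1 := hχ1 hx
      simp [this]
  have h := (ProbabilityMeasure.tendsto_iff_forall_integral_rclike_tendsto ℂ).1 hp
    (BoundedContinuousFunction.ofNormedAddCommGroup _ hψ c hc)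
  simp only [BoundedContinuousFunction.coe_ofNormedAddCommGroup] at h
  rw [hcongr _ hqK] at h
  exact h.congr' (hpK.mono fun i hi => hcongr _ hi)

end Hutchinson

theorem proposition5 {m n : ℕ} (C : CutAndProject m n) (Ω : Set (Euc n)) (hΩ : IsWindow Ω)
    (Q : Euc m ≃ₗ[ℝ] Euc m) (A : Euc n →ₗ[ℝ] Euc n)
    (hQ : IsCompatibleSimilarity C Ω Q A) :
    -- the invariant density `f` is well defined
    (∃! f : Euc n → ℝ, C.IsInvariantWindowDensity Ω Q A f) ∧
    -- the Hutchinson measures `μ_s` are well defined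
    (∀ s : ℝ, 0 < s → (truncate (C.transl Ω A) s).Nonempty →
      ∃! μ : Measure (Euc n), C.IsHutchinsonMeasure Ω A s μ) ∧
    ∀ f : Euc n → ℝ, C.IsInvariantWindowDensity Ω Q A f →
    ∀ μ : ℝ → Measure (Euc n),
      (∀ s : ℝ, 0 < s → (truncate (C.transl Ω A) s).Nonempty →
        C.IsHutchinsonMeasure Ω A s (μ s)) →
      -- the product formula
      (∀ s : ℝ, 0 < s → (truncate (C.transl Ω A) s).Nonempty → ∀ k : Euc n,
        HasProd (fun N : ℕ => C.expAverage Ω A s ((LinearMap.adjoint A ^ N) k))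
          (fourierMeasure (μ s) k)) ∧
      -- uniform convergence of the Fourier transforms on compact sets
      (∀ K : Set (Euc n), IsCompact K →
        TendstoUniformlyOn (fun (s : ℝ) (k : Euc n) => fourierMeasure (μ s) k)
          (fourierMeasure (densityMeasure f)) atTop K) ∧
      -- weak convergence of the measures
      (∀ φ : Euc n → ℂ, Continuous φ →
        Tendsto (fun s : ℝ => ∫ x, φ x ∂(μ s)) atTop (𝓝 (∫ x, φ x ∂(densityMeasure f)))) := by
  obtain ⟨f₀, hf₀⟩ := hQ.exists_isInvariantWindowDensity hΩ
  refine ⟨⟨f₀, hf₀, fun g hg => hQ.isInvariantWindowDensity_unique hΩ hg hf₀⟩,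
    fun s _ hs => hQ.existsUnique_isHutchinsonMeasure hΩ hs, fun f hf μ hμ =>
    ⟨fun s hs0 hs k => hQ.hasProd_fourierMeasure hΩ hs (hμ s hs0 hs) k, ?_⟩⟩
  have hW := isCompact_windowQ (A := A) hΩ.isCompact hΩ.nonempty
  have hev : ∀ᶠ s : ℝ in atTop, 0 < s ∧ (truncate (C.transl Ω A) s).Nonempty :=
    (eventually_gt_atTop 0).and (C.eventually_truncate_modelSet_nonempty hQ.interior_nonempty)
  obtain ⟨hfprob, hfself⟩ := hQ.densityMeasure_eq_conv_map hΩ hf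
  have hfΩ : densityMeasure f Ωᶜ = 0 := by
    have hf0 := ((hQ.isInvariantWindowDensity_iff hΩ).1 hf).2.1
    rw [densityMeasure, withDensity_apply _ hΩ.isCompact.measurableSet.compl,
      setLIntegral_congr_fun (g := fun _ => 0) hΩ.isCompact.measurableSet.compl
        fun y hy => by simp [hf0 y hy]]
    simp
  have := hQ.isProbabilityMeasure_cond_windowQ hΩ
  set q : ProbabilityMeasure (Euc n) := ⟨densityMeasure f, hfprob⟩ with hq
  classical
  -- `μ s` is unconstrained for small `s`; there it is replaced by some probability measure
  set p : ℝ → ProbabilityMeasure (Euc n) := fun s =>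
    if h : 0 < s ∧ (truncate (C.transl Ω A) s).Nonempty then
      ⟨μ s, (hμ s h.1 h.2).isProbabilityMeasure⟩ else q with hp
  have hpμ : ∀ᶠ s in atTop, (p s : Measure (Euc n)) = μ s := by
    filter_upwards [hev] with s hs
    exact congrArg Subtype.val (dif_pos hs)
  have hpΩ : ∀ᶠ s in atTop, (p s : Measure (Euc n)) Ωᶜ = 0 := by
    filter_upwards [hpμ, hev] with s h1 h2
    rw [h1]
    exact (hμ s h2.1 h2.2).compl_null
  have hlim : Tendsto p atTop (𝓝 q) := by
    refine tendsto_of_charFun_selfSimilar hQ.tendsto_adjoint_pow hΩ.isCompact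
      (C.tendsto_charFun_starMeasure hW hQ.frontier_null hQ.interior_nonempty) ?_ fun t => ?_
    · filter_upwards [hpμ, hpΩ, hev] with s h1 h2 h3
      refine ⟨h2, ?_⟩
      rw [h1]
      exact IsCompatibleSimilarity.charFun_hutchinson hΩ h3.2 (hμ s h3.1 h3.2)
    · change charFun (densityMeasure f) t = _ * charFun (densityMeasure f) _
      conv_lhs => rw [hfself, charFun_conv_map]
  refine ⟨fun K hK => ?_, fun φ hφ => ?_⟩
  · obtain ⟨R, hR⟩ := hΩ.isCompact.isBounded.exists_norm_le
    have hR0 : 0 ≤ R := (norm_nonneg _).trans (hR _ hΩ.nonempty.some_mem)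
    refine tendstoUniformlyOn_of_lipschitz (c := ⟨R * (2 * Real.pi), by positivity⟩) ?_
      (fun k => ?_) hK
    · filter_upwards [hev] with s hs
      have hH := hμ s hs.1 hs.2
      have := hH.isProbabilityMeasure
      have hae : ∀ᵐ x ∂(μ s), x ∈ Ω := hH.compl_null
      refine LipschitzWith.of_dist_le_mul fun k k' => ?_
      rw [fourierMeasure_eq_charFun, fourierMeasure_eq_charFun, dist_eq_norm]
      refine (norm_charFun_sub_le (hae.mono fun x hx => hR x hx) _ _).trans (le_of_eq ?_)
      rw [← smul_sub, norm_smul, norm_neg, Real.norm_of_nonneg (by positivity), ← mul_assoc,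
        dist_eq_norm]
      rfl
    · simp_rw [fourierMeasure_eq_charFun]
      exact (tendsto_charFun_of_tendsto hlim _).congr' (hpμ.mono fun s hs => by rw [hs])
  · exact (tendsto_integral_of_compl_eq_zero hΩ.isCompact hlim hpΩ hfΩ hφ).congr'
      (hpμ.mono fun s hs => by rw [hs])
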